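/- Let $X$ be an infinite-dimensional separable real Hilbert space, let $\gamma$ be a non-degenerate centered Gaussian (Borel probability) measure on $X$, and let $Qy=\int_X\langle x,y\rangle x\,d\gamma(x)$ be its covariance operator. Let $R g=\int_X g(x)\,x\,d\gamma(x)$ for $g$ in the closure $\mathcal H$ of $X^*$ in $L^2(X,\gamma)$; the Cameron–Martin space is $H=R(\mathcal H)$, normed by $|R g|_H=\|g\|_{L^2(X,\gamma)}$, and we write $\hat h=R^{-1}h$ for $h\in H$. The perimeter of a Borel set $E\subset X$ is $$P_\gamma(E)=\sup\Big\{\int_E \operatorname{div}_\gamma\varphi\,d\gamma:\ \varphi=\sum_{i=1}^n f_i\ell_i,\ |\varphi(x)|_H\le 1\ \ \forall x\in X\Big\},\qquad \operatorname{div}_\gamma\varphi=\sum_{i=1}^n\big(\partial_{\ell_i}f_i-\hat\ell_i f_i\big),$$ where $n\in\mathbb N$, $\ell_i\in H$, and each $f_i$ is of the form $f_i(x)=\phi(\langle x,y_1\rangle,\dots,\langle x,y_m\rangle)$ with $m\in\mathbb N$, $y_1,\dots,y_m\in X$ and $\phi\in C^1(\mathbb R^m)$ bounded with bounded derivative. There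 is a sequence of positive numbers $(r_k)_{k\ge1}$, not depending on $X$ or $\gamma$, with $\sqrt{\log(k+1)}\le r_k\le 2\sqrt{\log(k+1)}$ for all sufficiently large $k$, such that for all $X$ and $\gamma$ as above the following holds. The space $X$ has an orthonormal basis $(e_k)_{k\ge1}$ with $Qe_k=\lambda_ke_k$ and $\lambda_1\ge\lambda_2\ge\cdots$; and for every such basis the Hilbert cube $$C=\{x\in X:\ |\langle x,e_k\rangle|\le \sqrt{\lambda_k}\,r_k\ \text{ for all } k\ge1\}$$ (whose half side lengths, with respect to the orthonormal basis $\sqrt{\lambda_k}\,e_k$ of $H$, are the $r_k$) is closed and convex, $\gamma(C)>0$, and $P_\gamma(C)=+\infty$. Moreover, if $\sum_{j\ge1}\lambda_j\log j<+\infty$, then $C$ is compact. -/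

import Mathlib

open MeasureTheory ProbabilityTheory Filter
open scoped ENNReal

noncomputable section

namespace GaussPerimeter

section Banach

variable {X : Type*} [NormedAddCommGroup X] [NormedSpace ℝ X] [MeasurableSpace X] [BorelSpace X]

/-- A Gaussian measure is non-degenerate if every nonzero continuous linear functional has
positive variance. -/
def IsNondegenerate (γ : Measure X) : Prop :=
  ∀ L : StrongDual ℝ X, L ≠ 0 → 0 < Var[fun x ↦ L x; γ]

/-- The reproducing kernel of `γ`: the closure in `L²(X, γ)` of the continuous linear functionals.
(For a Gaussian `γ` all functionals are in `L²`, and `StrongDual.toLp` is the inclusion.) -/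
def reproducingKernel (γ : Measure X) : Submodule ℝ (Lp ℝ 2 γ) :=
  (LinearMap.range (StrongDual.toLp (𝕜 := ℝ) γ 2).toLinearMap).topologicalClosure

/-- The map `R g = ∫ g(x) x dγ(x)`. -/
def cmEmbed (γ : Measure X) (g : reproducingKernel γ) : X :=
  ∫ x, (g : Lp ℝ 2 γ) x • x ∂γ

/-- The Cameron-Martin space `H`. The vector of `X` represented by `g` is `cmEmbed γ g`. As `H`
carries by definition the Hilbert structure that makes `R` an isometry of the reproducing kernel
onto `H`, its elements are recorded by their preimages under `R`: the element `h` of `H` is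
recorded by the function `ĥ` in `L²(X, γ)` with `R ĥ = h`, and `|h|_H = ‖ĥ‖`. -/
abbrev CameronMartin (γ : Measure X) : Type _ := reproducingKernel γ

/-- Cylindrical functions `x ↦ φ (L₁ x, …, L_m x)` with `φ` of class `C¹`, bounded, with bounded
derivative. -/
def IsCylindricalC1b (f : X → ℝ) : Prop :=
  ∃ (m : ℕ) (L : Fin m → StrongDual ℝ X) (φ : (Fin m → ℝ) → ℝ),
    ContDiff ℝ 1 φ ∧ (∃ M : ℝ, ∀ y, |φ y| ≤ M) ∧ (∃ M : ℝ, ∀ y, ‖fderiv ℝ φ y‖ ≤ M) ∧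
      f = fun x ↦ φ (fun i ↦ L i x)

/-- The `H`-valued field `x ↦ ∑ i, f i x • h i`. -/
def cylField (γ : Measure X) {n : ℕ} (f : Fin n → X → ℝ) (h : Fin n → CameronMartin γ) (x : X) :
    CameronMartin γ :=
  ∑ i, f i x • h i

/-- The Gaussian divergence `∑ i, (∂_{h i} (f i) - ĥ i · f i)` of the field `∑ i, f i • h i`
(defined `γ`-almost everywhere, as `ĥ i` is an element of `L²`). -/
def cylDiv (γ : Measure X) {n : ℕ} (f : Fin n → X → ℝ) (h : Fin n → CameronMartin γ) (x : X) : ℝ :=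
  ∑ i, (fderiv ℝ (f i) x (cmEmbed γ (h i)) - (h i : Lp ℝ 2 γ) x * f i x)

/-- The Gaussian perimeter of `E`: the supremum of `∫_E div_γ Φ dγ` over the cylindrical `C¹_b`
fields `Φ : X → H` with `|Φ(x)|_H ≤ 1` for all `x`. (The supremum is nonnegative, since `Φ = 0`
is admissible.) -/
def perimeter (γ : Measure X) (E : Set X) : ℝ≥0∞ :=
  ⨆ (n : ℕ) (f : Fin n → X → ℝ) (h : Fin n → CameronMartin γ)
    (_ : ∀ i, IsCylindricalC1b (f i)) (_ : ∀ x, ‖cylField γ f h x‖ ≤ 1),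
    ENNReal.ofReal (∫ x in E, cylDiv γ f h x ∂γ)

end Banach

section Hilbert

variable {X : Type*} [NormedAddCommGroup X] [InnerProductSpace ℝ X]

/-- The covariance operator `Q y = ∫ ⟨x, y⟩ x dγ(x)` of a centered Gaussian measure. -/
def covOp [MeasurableSpace X] (γ : Measure X) (y : X) : X :=
  ∫ x, inner ℝ x y • x ∂γ

/-- `e` is an orthonormal basis of eigenvectors of the covariance operator, and `lam` is the
sequence of the corresponding eigenvalues, in nonincreasing order (numbered from `0`). -/
structure IsEigensystem [MeasurableSpace X] (γ : Measure X) (e : HilbertBasis ℕ ℝ X)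
    (lam : ℕ → ℝ) : Prop where
  eigen : ∀ j, covOp γ (e j) = lam j • e j
  antitone : Antitone lam

/-- The Hilbert cube with axes `e k` and half side lengths `a k`. -/
def hilbertCube (e : HilbertBasis ℕ ℝ X) (a : ℕ → ℝ) : Set X :=
  {x | ∀ k, |inner ℝ x (e k)| ≤ a k}

end Hilbert

end GaussPerimeter

end

/-! In the coordinates `⟪x, e k⟫ / √(lam k)` the measure is a product of standard Gaussians and the
cube is the product of the intervals `[-r k, r k]`. Two different series govern its measure and its
perimeter. The measure is positive as soon as the tails outside the slabs are summable, and by the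
Mills bound such a tail is at most `exp (-r k ^ 2 / 2) / r k`. The perimeter is at least the total
weight of the faces: the k-th pair weighs `2 * gaussianPDFReal 0 1 (r k)` times the measure of the
box in the other coordinates, which is at least the measure of the cube. So it is infinite once `∑
exp (-r k ^ 2 / 2)` diverges. The gap is the factor `1 / r k`: if `exp (-r k ^ 2 / 2) = 1 / ((k + 3)
log (k + 3))`, the second series diverges, while the first is dominated by `∑ 1 / (k log (k) ^
(3/2))`. The bound on the perimeter (`le_perimeter_of_faceField`, `perimeter_box_eq_top`) comes from
explicit smooth fields. Component k is an odd profile, equal to `±1` on the k-th faces, times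
cutoffs in the other coordinates. The cutoffs keep the norm at most one, and they tend to one inside
the cube as the profiles sharpen. Integration by parts in one variable and independence
(`setIntegral_box_face`) give each face term. The eigenbasis comes from compactness of the
covariance operator; its eigenvalues have finite sum, so they can be sorted. -/

namespace GaussPerimeter

/-- A positive function tending to zero along the cofinite filter on an infinite type can be
arranged in nonincreasing order. -/
theorem exists_equiv_nat_antitone {ι : Type*} [Infinite ι] (l : ι → ℝ) (hpos : ∀ i, 0 < l i)
    (hl : Tendsto l cofinite (nhds 0)) : ∃ σ : ℕ ≃ ι, Antitone (l ∘ σ) := by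
  classical
  have hfin : ∀ c > 0, {i | c ≤ l i}.Finite := fun c hc ↦ by
    have h := hl.eventually (gt_mem_nhds hc)
    rw [eventually_cofinite] at h
    simpa using h
  have hmax : ∀ s : Finset ι, ∃ i ∉ s, ∀ j ∉ s, l j ≤ l i := fun s ↦ by
    obtain ⟨i₀, hi₀⟩ := Infinite.exists_notMem_finset s
    -- Only finitely many values reach `l i₀`, so a maximum outside `s` exists; `m s` picks one, and
    -- iterating `m` enumerates greedily.
    have hf : ({i | l i₀ ≤ l i} \ s).Finite := (hfin _ (hpos i₀)).sdiff
    obtain ⟨i, hi, hmax⟩ := Set.exists_max_image _ l hf ⟨i₀, by simpa using hi₀⟩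
    refine ⟨i, by simpa using hi.2, fun j hj ↦ ?_⟩
    by_cases h : l i₀ ≤ l j
    · exact hmax j ⟨h, by simpa using hj⟩
    · exact (not_le.1 h).le.trans hi.1
  choose m hm hm' using hmax
  let F : ℕ → Finset ι := fun n ↦ Nat.rec ∅ (fun _ s ↦ insert (m s) s) n
  have hF : ∀ n, F (n + 1) = insert (m (F n)) (F n) := fun n ↦ rfl
  have hmono : Monotone F := monotone_nat_of_le_succ fun n ↦ by
    rw [hF]; exact Finset.subset_insert _ _
  let e : ℕ → ι := fun n ↦ m (F n)
  have hmem : ∀ {a b}, a < b → e a ∈ F b := fun {a b} h ↦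
    hmono h (by rw [hF]; exact Finset.mem_insert_self _ _)
  have hinj : Function.Injective e := by
    intro a b hab
    by_contra hne
    rcases lt_or_gt_of_ne hne with h | h
    · exact hm (F b) (by simpa [e, ← hab] using hmem h)
    · exact hm (F a) (by simpa [e, hab] using hmem h)
  have hanti : Antitone (l ∘ e) := fun a b hab ↦
    hm' (F a) _ fun h ↦ hm (F b) (hmono hab h)
  have hFmem : ∀ n, ∀ i ∈ F n, ∃ k, e k = i := by
    intro n
    induction n with
    | zero => intro i hi; exact absurd hi (Finset.notMem_empty _)
    | succ n ih =>
      intro i hi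
      rw [hF, Finset.mem_insert] at hi
      rcases hi with rfl | hi
      · exact ⟨n, rfl⟩
      · exact ih i hi
  have hsurj : Function.Surjective e := by
    intro i
    by_contra hne
    -- A missed index would force infinitely many values to be at least `l i`.
    have hle : ∀ n, l i ≤ l (e n) := fun n ↦ hm' (F n) i fun h ↦ hne (hFmem n i h)
    exact Set.infinite_range_of_injective hinj
      ((hfin _ (hpos i)).subset (by rintro _ ⟨n, rfl⟩; exact hle n))
  exact ⟨Equiv.ofBijective e ⟨hinj, hsurj⟩, hanti⟩

/-! ### Spectral theory of the covariance operator -/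

section Spectral

variable {X : Type*} [NormedAddCommGroup X] [InnerProductSpace ℝ X] [CompleteSpace X]
  [MeasurableSpace X] [BorelSpace X]

open scoped RealInnerProductSpace

theorem covOp_eq (γ : Measure X) (h2 : MemLp id 2 γ) (y : X) :
    covOp γ y = covarianceOperator γ y := by
  simp_rw [covOp, covarianceOperator_apply h2, real_inner_comm]

theorem inner_covOp (γ : Measure X) (h2 : MemLp id 2 γ) (x y : X) :
    ⟪covOp γ x, y⟫ = ∫ z, ⟪z, x⟫ * ⟪z, y⟫ ∂γ := by
  simp_rw [covOp_eq γ h2, covarianceOperator_inner h2, real_inner_comm]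

variable [SecondCountableTopology X]

/-- The uncentered covariance operator of a measure with finite second moment is compact. -/
theorem isCompactOperator_covarianceOperator (γ : Measure X) (h2 : MemLp id 2 γ) :
    IsCompactOperator (covarianceOperator γ) := by
  classical
  obtain ⟨d, hd⟩ := TopologicalSpace.exists_dense_seq X
  let U : ℕ → Submodule ℝ X := fun n ↦ Submodule.span ℝ (d '' Set.Iic n)
  have hfd : ∀ n, FiniteDimensional ℝ (U n) := fun n ↦
    FiniteDimensional.span_of_finite ℝ ((Set.finite_Iic n).image d)
  have hUmono : Monotone U := fun a b hab ↦
    Submodule.span_mono (Set.image_mono (Set.Iic_subset_Iic.2 hab))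
  have hUtop : ⊤ ≤ (⨆ n, U n).topologicalClosure := by
    intro x _
    refine closure_mono (s := Set.range d) ?_ (hd x)
    rintro _ ⟨n, rfl⟩
    exact Submodule.mem_iSup_of_mem n (Submodule.subset_span ⟨n, by simp, rfl⟩)
  have htend : ∀ x, Tendsto (fun n ↦ (U n).starProjection x) atTop (nhds x) := fun x ↦
    Submodule.starProjection_tendsto_self U hUmono x hUtop
  have hsq : Integrable (fun x : X ↦ ‖x‖ ^ 2) γ := h2.integrable_norm_pow (by norm_num)
  have hbd : ∀ n x, ‖x - (U n).starProjection x‖ ≤ ‖x‖ := fun n x ↦ by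
    have h := (U n)ᗮ.norm_starProjection_apply_le x
    rwa [Submodule.starProjection_orthogonal_val] at h
  have hlim : Tendsto (fun n ↦ ∫ x, ‖x‖ * ‖x - (U n).starProjection x‖ ∂γ) atTop
      (nhds 0) := by
    have := tendsto_integral_of_dominated_convergence (μ := γ) (f := fun _ ↦ (0 : ℝ))
      (F := fun n x ↦ ‖x‖ * ‖x - (U n).starProjection x‖) (fun x ↦ ‖x‖ ^ 2)
      (fun n ↦ by fun_prop) hsq
      (fun n ↦ .of_forall fun x ↦ by
        rw [Real.norm_of_nonneg (by positivity), sq]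
        gcongr; exact hbd n x)
      (.of_forall fun x ↦ by
        have h1 : Tendsto (fun n ↦ x - (U n).starProjection x) atTop (nhds 0) := by
          simpa using (htend x).const_sub x
        simpa using h1.norm.const_mul ‖x‖)
    simpa using this
  -- Finite-rank truncations converge in operator norm, with error at most the integral in `hlim`.
  refine isCompactOperator_of_tendsto (l := atTop)
    (F := fun n ↦ (U n).starProjection ∘L covarianceOperator γ) ?_ (.of_forall fun n ↦ ?_)
  · rw [tendsto_iff_norm_sub_tendsto_zero]
    refine squeeze_zero (fun _ ↦ norm_nonneg _) (fun n ↦ ?_) hlim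
    refine ContinuousLinearMap.opNorm_le_bound _ (integral_nonneg fun _ ↦ by positivity)
      fun y ↦ ?_
    have hint : Integrable (fun x : X ↦ ⟪y, x⟫ • x) γ :=
      memLp_one_iff_integrable.1 <| h2.smul (h2.const_inner y)
    rw [_root_.sub_apply, ContinuousLinearMap.comp_apply,
      covarianceOperator_apply h2, ← ContinuousLinearMap.integral_comp_comm _ hint,
      ← integral_sub ((ContinuousLinearMap.integrable_comp _ hint)) hint, mul_comm,
      ← integral_const_mul]
    refine norm_integral_le_of_norm_le ?_ (.of_forall fun x ↦ ?_)
    · refine (hsq.mono' (by fun_prop) (.of_forall fun x ↦ ?_)).const_mul _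
      rw [Real.norm_of_nonneg (by positivity), sq]
      gcongr; exact hbd n x
    · rw [map_smul, ← smul_sub, norm_smul, norm_sub_rev, ← mul_assoc]
      gcongr
      exact norm_inner_le_norm y x
  · have := FiniteDimensional.proper ℝ (U n)
    have h : IsCompactOperator (U n).orthogonalProjectionOnto :=
      isCompactOperator_of_locallyCompactSpace_dom _
    exact (h.clm_comp (U n).subtypeL).comp_clm (covarianceOperator γ)

/-- Centering makes this second moment a variance. -/
theorem inner_covOp_self_pos (γ : Measure X) [IsGaussian γ] (hc : ∫ x, x ∂γ = 0)
    (hnd : IsNondegenerate γ) {x : X} (hx : x ≠ 0) : 0 < ⟪covOp γ x, x⟫ := by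
  have h := hnd (innerSL ℝ x) fun h0 ↦ hx (by simpa using congr($h0 x))
  have hm : ∫ z, ⟪x, z⟫ ∂γ = 0 := by
    rw [integral_inner IsGaussian.integrable_fun_id, hc, inner_zero_right]
  rw [inner_covOp γ IsGaussian.memLp_two_id]
  rw [variance_of_integral_eq_zero (by fun_prop) (by simpa using hm)] at h
  simpa [sq, real_inner_comm] using h

/-- A centered nondegenerate Gaussian measure on an infinite dimensional separable Hilbert space
has an eigensystem. -/
theorem exists_isEigensystem (γ : Measure X) [IsGaussian γ] (hinf : ¬ FiniteDimensional ℝ X)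
    (hc : ∫ x, x ∂γ = 0) (hnd : IsNondegenerate γ) :
    ∃ (e : HilbertBasis ℕ ℝ X) (lam : ℕ → ℝ), IsEigensystem γ e lam := by
  classical
  have h2 : MemLp id 2 γ := IsGaussian.memLp_two_id
  set T := covarianceOperator γ
  have hsymm : T.toLinearMap.IsSymmetric := isPositive_covarianceOperator.isSymmetric
  have hK : IsCompactOperator T := isCompactOperator_covarianceOperator γ h2
  have horth := ContinuousLinearMap.orthogonalComplement_iSup_eigenspaces_eq_bot hK hsymm
  let E : ℝ → Submodule ℝ X := fun μ ↦ Module.End.eigenspace T.toLinearMap μ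
  have hcl : ∀ μ, IsClosed (E μ : Set X) := fun μ ↦ by
    have : (E μ : Set X) = {x | T x = μ • x} := by
      ext x; simp [E]
    rw [this]; exact isClosed_eq (by fun_prop) (by fun_prop)
  have : ∀ μ, CompleteSpace (E μ) := fun μ ↦ (hcl μ).completeSpace_coe
  choose w b hb using fun μ ↦ exists_hilbertBasis ℝ (E μ)
  let v : (Σ μ, w μ) → X := fun p ↦ (b p.1 p.2 : X)
  have hv : Orthonormal ℝ v :=
    (hsymm.orthogonalFamily_eigenspaces).orthonormal_sigma_orthonormal fun μ ↦ (b μ).orthonormal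
  -- A vector orthogonal to the bases of all eigenspaces is orthogonal to the eigenspaces, hence
  -- zero by the spectral theorem.
  have hspan : (Submodule.span ℝ (Set.range v))ᗮ = ⊥ := by
    rw [eq_bot_iff, ← horth]
    intro x hx
    rw [Submodule.mem_orthogonal] at hx ⊢
    have key : (⨆ μ, E μ) ≤ (ℝ ∙ x)ᗮ := by
      refine iSup_le fun μ y hy ↦ ?_
      rw [Submodule.mem_orthogonal_singleton_iff_inner_left]
      have h1 := (b μ).hasSum_repr ⟨y, hy⟩
      have h2 := ((innerSL ℝ x) ∘L (E μ).subtypeL).hasSum h1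
      have h3 := h2.unique (a₂ := 0) (by
        convert hasSum_zero using 2 with i
        have := hx (v ⟨μ, i⟩) (Submodule.subset_span ⟨_, rfl⟩)
        simp [real_inner_comm, v] at this ⊢
        exact Or.inr this)
      rw [real_inner_comm]
      simpa using h3
    intro u hu
    exact Submodule.mem_orthogonal_singleton_iff_inner_left.1 (key hu)
  let B := HilbertBasis.mkOfOrthogonalEqBot hv hspan
  have hB : ⇑B = v := HilbertBasis.coe_mkOfOrthogonalEqBot hv hspan
  have heig : ∀ p, T (B p) = p.1 • B p := fun p ↦ by
    rw [hB]
    exact Module.End.mem_eigenspace_iff.1 (b p.1 p.2).2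
  have hInf : Infinite (Σ μ, w μ) := by
    by_contra hf
    have : Finite (Σ μ, w μ) := not_infinite_iff_finite.1 hf
    have := Fintype.ofFinite (Σ μ, w μ)
    exact hinf (B.toOrthonormalBasis.toBasis.finiteDimensional_of_finite)
  have hval : ∀ p, p.1 = ∫ z, ⟪z, B p⟫ ^ 2 ∂γ := fun p ↦ by
    have h := inner_covOp γ h2 (B p) (B p)
    rw [covOp_eq γ h2, heig, real_inner_smul_left, real_inner_self_eq_norm_sq,
      B.orthonormal.1 p] at h
    simpa [sq] using h
  have hpos : ∀ p : Σ μ, w μ, 0 < p.1 := fun p ↦ by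
    have h := inner_covOp_self_pos γ hc hnd (x := B p) (B.orthonormal.ne_zero p)
    rwa [covOp_eq γ h2, heig, real_inner_smul_left, real_inner_self_eq_norm_sq,
      B.orthonormal.1 p, one_pow, mul_one] at h
  have hsq : Integrable (fun x : X ↦ ‖x‖ ^ 2) γ := h2.integrable_norm_pow (by norm_num)
  -- Each eigenvalue is the second moment of a coordinate, so Bessel's inequality bounds every
  -- partial sum by `∫ ‖x‖ ^ 2`.
  have hsum : Summable fun p : Σ μ, w μ ↦ p.1 := by
    refine summable_of_sum_le (c := ∫ x, ‖x‖ ^ 2 ∂γ) (fun p ↦ (hpos p).le) fun s ↦ ?_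
    simp_rw [hval]
    rw [← integral_finsetSum]
    · refine integral_mono ?_ hsq fun x ↦ ?_
      · refine integrable_finsetSum _ fun p _ ↦ ?_
        exact (h2.inner_const (B p)).integrable_sq
      · have := B.orthonormal.sum_inner_products_le x (s := s)
        simpa [real_inner_comm] using this
    · exact fun p _ ↦ (h2.inner_const (B p)).integrable_sq
  obtain ⟨σ, hσ⟩ := exists_equiv_nat_antitone (fun p : Σ μ, w μ ↦ p.1) hpos
    hsum.tendsto_cofinite_zero
  have hv' : Orthonormal ℝ (B ∘ σ) := B.orthonormal.comp _ σ.injective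
  have hspan' : (Submodule.span ℝ (Set.range (B ∘ σ)))ᗮ = ⊥ := by
    rwa [σ.surjective.range_comp, hB]
  refine ⟨.mkOfOrthogonalEqBot hv' hspan', fun n ↦ (σ n).1, fun j ↦ ?_, hσ⟩
  rw [HilbertBasis.coe_mkOfOrthogonalEqBot, covOp_eq γ h2]
  exact heig _

end Spectral

/-! ### The half side lengths and the two series -/

section SideLengths

open Real

/-- The shift by 3 is used because `e < 3`. -/
theorem one_le_log_nat_add_three (k : ℕ) : 1 ≤ log ((k : ℝ) + 3) := by
  rw [le_log_iff_exp_le (by positivity)]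
  have := exp_one_lt_d9
  have : (0 : ℝ) ≤ k := k.cast_nonneg
  linarith

/-- The half side lengths of the cube. -/
noncomputable def sideLength (k : ℕ) : ℝ :=
  √(2 * log ((k + 3) * log (k + 3)))

theorem one_lt_mul_log (k : ℕ) : 1 < ((k : ℝ) + 3) * log (k + 3) := by
  have := one_le_log_nat_add_three k
  have : (0 : ℝ) ≤ k := k.cast_nonneg
  nlinarith

theorem sideLength_pos (k : ℕ) : 0 < sideLength k :=
  sqrt_pos.2 (mul_pos two_pos (log_pos (one_lt_mul_log k)))

theorem sideLength_sq (k : ℕ) : sideLength k ^ 2 = 2 * log ((k + 3) * log (k + 3)) :=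
  sq_sqrt (mul_pos two_pos (log_pos (one_lt_mul_log k))).le

theorem exp_neg_sideLength_sq (k : ℕ) :
    exp (-sideLength k ^ 2 / 2) = (((k : ℝ) + 3) * log (k + 3))⁻¹ := by
  rw [sideLength_sq, show -(2 * log (((k : ℝ) + 3) * log (k + 3))) / 2 =
    -log (((k : ℝ) + 3) * log (k + 3)) by ring, exp_neg,
    exp_log (one_pos.trans (one_lt_mul_log k))]

theorem log_le_sideLength_sq (k : ℕ) : 2 * log (k + 3) ≤ sideLength k ^ 2 := by
  rw [sideLength_sq]
  have h := one_le_log_nat_add_three k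
  rw [log_mul (by positivity) (by positivity)]
  have := log_nonneg h
  linarith

theorem log_succ_sub_log_le {x : ℝ} (hx : 0 < x) : log (x + 1) - log x ≤ 1 / x := by
  rw [← log_div (by positivity) hx.ne']
  have := log_le_sub_one_of_pos (x := (x + 1) / x) (by positivity)
  have : (x + 1) / x - 1 = 1 / x := by field_simp; ring
  linarith

theorem le_log_succ_sub_log {x : ℝ} (hx : 0 < x) : 1 / (x + 1) ≤ log (x + 1) - log x := by
  have := log_le_sub_one_of_pos (x := x / (x + 1)) (by positivity)
  rw [log_div hx.ne' (by positivity)] at this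
  have : x / (x + 1) - 1 = -(1 / (x + 1)) := by field_simp; ring
  linarith

/-- Comparison with `log log`, whose increment from `x` to `x + 1` is at most `1 / (x log x)`. -/
theorem not_summable_exp_neg_sideLength_sq :
    ¬ Summable fun k : ℕ ↦ exp (-sideLength k ^ 2 / 2) := by
  simp_rw [exp_neg_sideLength_sq]
  rw [not_summable_iff_tendsto_nat_atTop_of_nonneg
    fun k ↦ inv_nonneg.2 (one_pos.trans (one_lt_mul_log k)).le]
  have hlow : ∀ n : ℕ, log (log ((n : ℝ) + 3)) - log (log 3) ≤
      ∑ k ∈ Finset.range n, (((k : ℝ) + 3) * log (k + 3))⁻¹ := by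
    intro n
    induction n with
    | zero => simp
    | succ n ih =>
      rw [Finset.sum_range_succ]
      have h1 := one_le_log_nat_add_three n
      have h2 := one_le_log_nat_add_three (n + 1)
      push_cast at h2 ⊢
      have h3 : log (log ((n : ℝ) + 1 + 3)) - log (log (n + 3)) ≤
          (((n : ℝ) + 3) * log (n + 3))⁻¹ := by
        rw [← log_div (by positivity) (by positivity)]
        refine (log_le_sub_one_of_pos (by positivity)).trans ?_
        have h4 := log_succ_sub_log_le (x := (n : ℝ) + 3) (by positivity)
        rw [show (n : ℝ) + 3 + 1 = n + 1 + 3 by ring] at h4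
        calc log ((n : ℝ) + 1 + 3) / log (n + 3) - 1
            = (log ((n : ℝ) + 1 + 3) - log (n + 3)) / log (n + 3) := by field_simp
          _ ≤ 1 / ((n : ℝ) + 3) / log (n + 3) := by gcongr
          _ = _ := by rw [div_div, one_div]
      linarith
  refine tendsto_atTop_mono hlow (tendsto_atTop_add_const_right _ _ ?_)
  exact tendsto_log_atTop.comp (tendsto_log_atTop.comp
    (tendsto_atTop_add_const_right _ _ tendsto_natCast_atTop_atTop))

/-- A discrete form of `∫ x ^ (-3/2) = -2 x ^ (-1/2)`, which makes the next series telescope. -/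
theorem sub_div_mul_sqrt_le {a b : ℝ} (ha : 0 < a) (hab : a ≤ b) :
    (b - a) / (b * √b) ≤ 2 * (1 / √a - 1 / √b) := by
  have hb := ha.trans_le hab
  have hs : 0 < √a := sqrt_pos.2 ha
  have ht : 0 < √b := sqrt_pos.2 hb
  have hst : √a ≤ √b := sqrt_le_sqrt hab
  have h1 : √b * √b = b := mul_self_sqrt hb.le
  have h2 : √a * √a = a := mul_self_sqrt ha.le
  generalize √a = s at *
  generalize √b = t at *
  subst h1 h2
  rw [div_sub_div _ _ hs.ne' ht.ne', ← mul_div_assoc, div_le_div_iff₀ (by positivity)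
    (by positivity)]
  -- Exactly the difference of the two sides after cross-multiplication.
  have : 0 ≤ (t - s) * t * (t - s) * (2 * t + s) := by
    have := sub_nonneg.2 hst
    positivity
  nlinarith [this]

/-- The term is at most `1 / ((k + 3) log (k + 3) ^ (3/2))`, and `1 / (k + 3)` is at most the
increment of `log` from `k + 2` to `k + 3`. -/
theorem summable_exp_neg_sideLength_sq_div :
    Summable fun k : ℕ ↦ exp (-sideLength k ^ 2 / 2) / sideLength k := by
  refine summable_of_sum_range_le (c := 2 * (1 / √(log 2)))
    (fun k ↦ div_nonneg (exp_nonneg _) (sideLength_pos k).le) fun n ↦ ?_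
  have hlog2 : 0 < log 2 := log_pos one_lt_two
  suffices h : ∑ k ∈ Finset.range n, exp (-sideLength k ^ 2 / 2) / sideLength k ≤
      2 * (1 / √(log 2) - 1 / √(log ((n : ℝ) + 2))) by
    have : 0 ≤ 1 / √(log ((n : ℝ) + 2)) := by positivity
    linarith
  induction n with
  | zero => simp
  | succ n ih =>
    rw [Finset.sum_range_succ]
    have h1 := one_le_log_nat_add_three n
    have ha : 0 < log ((n : ℝ) + 2) := log_pos (by linarith [n.cast_nonneg (α := ℝ)])
    have hb : 0 < log ((n : ℝ) + 3) := one_pos.trans_le h1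
    have hs := sideLength_pos n
    have hab : log ((n : ℝ) + 2) ≤ log (n + 3) := by gcongr; norm_num
    have h2 := sub_div_mul_sqrt_le ha hab
    have h3 := le_log_succ_sub_log (x := (n : ℝ) + 2) (by positivity)
    have h4 : √(log ((n : ℝ) + 3)) ≤ sideLength n := by
      rw [sqrt_le_left (sideLength_pos n).le]
      linarith [log_le_sideLength_sq n]
    rw [show (n : ℝ) + 2 + 1 = n + 3 by ring] at h3
    have h5 : exp (-sideLength n ^ 2 / 2) / sideLength n ≤
        (log ((n : ℝ) + 3) - log (n + 2)) / (log (n + 3) * √(log (n + 3))) := by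
      rw [exp_neg_sideLength_sq, mul_inv, ← one_div, div_eq_mul_inv _ (sideLength n),
        div_eq_mul_inv _ (_ * _), mul_inv, mul_assoc]
      gcongr
    push_cast
    rw [show (n : ℝ) + 1 + 2 = n + 3 by ring]
    linarith

theorem eventually_sideLength_bounds :
    ∀ᶠ k : ℕ in atTop, √(log ((k : ℝ) + 2)) ≤ sideLength k ∧
      sideLength k ≤ 2 * √(log ((k : ℝ) + 2)) := by
  filter_upwards [eventually_ge_atTop 4] with k hk
  have hk' : (4 : ℝ) ≤ k := by exact_mod_cast hk
  have h1 := one_le_log_nat_add_three k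
  have h2 : 0 ≤ log ((k : ℝ) + 2) := log_nonneg (by linarith)
  constructor
  · rw [sqrt_le_left (sideLength_pos k).le]
    have : log ((k : ℝ) + 2) ≤ log (k + 3) := by gcongr; norm_num
    linarith [log_le_sideLength_sq k]
  · refine (sq_le_sq₀ (sideLength_pos k).le (by positivity)).1 ?_
    rw [sideLength_sq, mul_pow, sq_sqrt h2]
    -- This gives `(k + 3) log (k + 3) ≤ (k + 3) ^ 2 / 2 ≤ (k + 2) ^ 2`, hence the factor 2 after
    -- taking logarithms.
    have h3 : log ((k : ℝ) + 3) ≤ (k + 3) / 2 := by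
      have h4 := log_le_sub_one_of_pos (x := ((k : ℝ) + 3) / 2) (by positivity)
      rw [log_div (by positivity) two_ne_zero] at h4
      linarith [log_two_lt_d9]
    have h5 : log (((k : ℝ) + 3) * log (k + 3)) ≤ log (((k : ℝ) + 2) ^ 2) := by
      refine log_le_log (by positivity) ?_
      nlinarith
    rw [log_pow] at h5
    push_cast at h5
    linarith

end SideLengths

/-! ### The one-dimensional Gaussian: integration by parts and tails -/

section Gaussian

open Real

theorem gaussianPDFReal_zero_one (t : ℝ) :
    gaussianPDFReal 0 1 t = (√(2 * π))⁻¹ * exp (-t ^ 2 / 2) := by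
  simp [gaussianPDFReal]

theorem hasDerivAt_gaussianPDFReal (t : ℝ) :
    HasDerivAt (gaussianPDFReal 0 1) (-t * gaussianPDFReal 0 1 t) t := by
  have h : HasDerivAt (fun x : ℝ ↦ -x ^ 2 / 2) (-t) t :=
    ((hasDerivAt_pow 2 t).neg.div_const 2).congr_deriv (by norm_num; ring)
  rw [funext gaussianPDFReal_zero_one]
  exact (h.exp.const_mul _).congr_deriv (by ring)

theorem gaussianPDFReal_neg (t : ℝ) : gaussianPDFReal 0 1 (-t) = gaussianPDFReal 0 1 t := by
  simp [gaussianPDFReal_zero_one]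

/-- Integration by parts against the standard Gaussian measure on a symmetric interval. -/
theorem setIntegral_deriv_sub_mul_gaussianReal {g g' : ℝ → ℝ} {r : ℝ} (hr : 0 ≤ r)
    (hg : ∀ t, HasDerivAt g (g' t) t) (hg' : Continuous g') :
    ∫ t in Set.Icc (-r) r, (g' t - t * g t) ∂gaussianReal 0 1 =
      (g r - g (-r)) * gaussianPDFReal 0 1 r := by
  have hgc : Continuous g := continuous_iff_continuousAt.2 fun t ↦ (hg t).continuousAt
  have hpc : Continuous (gaussianPDFReal 0 1) :=
    continuous_iff_continuousAt.2 fun t ↦ (hasDerivAt_gaussianPDFReal t).continuousAt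
  rw [← integral_indicator measurableSet_Icc, integral_gaussianReal_eq_integral_smul one_ne_zero]
  -- The density `p` satisfies `p' = -t p`, so the integrand times `p` is `(g p)'`.
  have : ∀ t, gaussianPDFReal 0 1 t • (Set.Icc (-r) r).indicator (fun t ↦ g' t - t * g t) t =
      (Set.Icc (-r) r).indicator
        (fun t ↦ g' t * gaussianPDFReal 0 1 t + g t * (-t * gaussianPDFReal 0 1 t)) t := by
    intro t
    by_cases ht : t ∈ Set.Icc (-r) r
    · simp [ht]; ring
    · simp [ht]
  simp_rw [this]
  rw [integral_indicator measurableSet_Icc, integral_Icc_eq_integral_Ioc,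
    ← intervalIntegral.integral_of_le (by linarith),
    intervalIntegral.integral_eq_sub_of_hasDerivAt
      (f := fun t ↦ g t * gaussianPDFReal 0 1 t)
      (fun t _ ↦ (hg t).mul (hasDerivAt_gaussianPDFReal t))
      (Continuous.intervalIntegrable (by fun_prop) _ _), gaussianPDFReal_neg]
  ring

theorem tendsto_gaussianPDFReal_atTop :
    Tendsto (gaussianPDFReal 0 1) atTop (nhds 0) := by
  have h : Tendsto (fun t : ℝ ↦ -t ^ 2 / 2) atTop atBot := by
    refine Tendsto.atBot_div_const two_pos ?_
    exact tendsto_neg_atTop_atBot.comp (tendsto_pow_atTop two_ne_zero)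
  have := (tendsto_exp_atBot.comp h).const_mul (√(2 * π))⁻¹
  simpa [gaussianPDFReal_def, Function.comp_def] using this

/-- On the tail `1 ≤ t / r`, and `t` times the density has an exact primitive. -/
theorem gaussianReal_Ioi_le {r : ℝ} (hr : 0 < r) :
    gaussianReal 0 1 (Set.Ioi r) ≤ ENNReal.ofReal (gaussianPDFReal 0 1 r / r) := by
  rw [gaussianReal_apply_eq_integral 0 one_ne_zero]
  refine ENNReal.ofReal_le_ofReal ?_
  have hder : ∀ t ∈ Set.Ici r, HasDerivAt (fun t ↦ -(gaussianPDFReal 0 1 t / r))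
      (t / r * gaussianPDFReal 0 1 t) t := fun t _ ↦ by
    exact ((hasDerivAt_gaussianPDFReal t).div_const r).neg.congr_deriv (by ring)
  have hpos : ∀ t ∈ Set.Ioi r, 0 ≤ t / r * gaussianPDFReal 0 1 t := fun t ht ↦
    mul_nonneg (div_nonneg (hr.le.trans (le_of_lt ht)) hr.le) (gaussianPDFReal_nonneg _ _ _)
  have hlim : Tendsto (fun t ↦ -(gaussianPDFReal 0 1 t / r)) atTop (nhds 0) := by
    simpa using (tendsto_gaussianPDFReal_atTop.div_const r).neg
  have h := integral_Ioi_of_hasDerivAt_of_nonneg' hder hpos hlim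
  rw [zero_sub, neg_neg] at h
  rw [← h]
  refine setIntegral_mono_on (integrable_gaussianPDFReal 0 1).integrableOn
    (integrableOn_Ioi_deriv_of_nonneg' hder hpos hlim) measurableSet_Ioi fun t ht ↦ ?_
  refine le_mul_of_one_le_left (gaussianPDFReal_nonneg _ _ _) ?_
  rw [one_le_div hr]
  exact le_of_lt ht

/-- The Mills ratio bound for both tails of the standard Gaussian measure. -/
theorem gaussianReal_real_compl_Icc_le {r : ℝ} (hr : 0 < r) :
    (gaussianReal 0 1).real (Set.Icc (-r) r)ᶜ ≤ exp (-r ^ 2 / 2) / r := by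
  have hsymm : gaussianReal 0 1 (Set.Iio (-r)) = gaussianReal 0 1 (Set.Ioi r) := by
    have h := gaussianReal_map_neg (μ := 0) (v := 1)
    rw [neg_zero] at h
    conv_lhs => rw [← h, Measure.map_apply measurable_neg measurableSet_Iio]
    congr 1
    ext t; simp
  have hsub : (Set.Icc (-r) r)ᶜ ⊆ Set.Iio (-r) ∪ Set.Ioi r := by
    intro t ht
    by_contra h
    simp only [Set.mem_union, Set.mem_Iio, Set.mem_Ioi, not_or, not_lt] at h
    exact ht ⟨h.1, h.2⟩
  have hle : gaussianReal 0 1 (Set.Icc (-r) r)ᶜ ≤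
      ENNReal.ofReal (2 * (gaussianPDFReal 0 1 r / r)) := by
    calc gaussianReal 0 1 (Set.Icc (-r) r)ᶜ
        ≤ gaussianReal 0 1 (Set.Iio (-r)) + gaussianReal 0 1 (Set.Ioi r) :=
          (measure_mono hsub).trans (measure_union_le _ _)
      _ = 2 * gaussianReal 0 1 (Set.Ioi r) := by rw [hsymm, two_mul]
      _ ≤ 2 * ENNReal.ofReal (gaussianPDFReal 0 1 r / r) := by
          gcongr; exact gaussianReal_Ioi_le hr
      _ = _ := by rw [ENNReal.ofReal_mul two_pos.le]; simp
  have hp : 0 ≤ gaussianPDFReal 0 1 r := gaussianPDFReal_nonneg _ _ _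
  refine (ENNReal.toReal_le_of_le_ofReal (by positivity) hle).trans ?_
  rw [← mul_div_assoc]
  gcongr
  -- The normalizing constant absorbs the factor 2 from the two tails.
  have h2 : (2 : ℝ) ≤ √(2 * π) := by
    rw [le_sqrt' two_pos]; nlinarith [pi_gt_three]
  rw [gaussianPDFReal_zero_one, ← mul_assoc]
  refine mul_le_of_le_one_left (exp_nonneg _) ?_
  rw [← div_eq_mul_inv]
  exact div_le_one_of_le₀ h2 (by positivity)

end Gaussian

/-! ### Profiles and cutoffs for the test fields -/

section FaceProfile

open Real

/-- A smooth odd profile with values `±1` at `±r` that, for large `n`, is concentrated near `±r`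
on the interval `[-r, r]`. -/
noncomputable def faceProfile (n : ℕ) (r t : ℝ) : ℝ := sin (π / (2 * r) * t) ^ (2 * n + 1)

noncomputable def faceProfileDeriv (n : ℕ) (r t : ℝ) : ℝ :=
  (2 * n + 1) * sin (π / (2 * r) * t) ^ (2 * n) * (cos (π / (2 * r) * t) * (π / (2 * r)))

/-- The cutoff complementary to `faceProfile`. -/
noncomputable def faceCutoff (n : ℕ) (r t : ℝ) : ℝ := 1 - faceProfile n r t ^ 2

theorem hasDerivAt_faceProfile (n : ℕ) (r t : ℝ) :
    HasDerivAt (faceProfile n r) (faceProfileDeriv n r t) t := by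
  have h : HasDerivAt (fun t ↦ π / (2 * r) * t) (π / (2 * r)) t := by
    simpa using (hasDerivAt_id t).const_mul (π / (2 * r))
  refine (h.sin.pow (2 * n + 1)).congr_deriv ?_
  simp [faceProfileDeriv]

theorem continuous_faceProfile (n : ℕ) (r : ℝ) : Continuous (faceProfile n r) := by
  unfold faceProfile; fun_prop

theorem continuous_faceProfileDeriv (n : ℕ) (r : ℝ) : Continuous (faceProfileDeriv n r) := by
  unfold faceProfileDeriv; fun_prop

theorem continuous_faceCutoff (n : ℕ) (r : ℝ) : Continuous (faceCutoff n r) := by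
  unfold faceCutoff; have := continuous_faceProfile n r; fun_prop

theorem faceProfile_self (n : ℕ) {r : ℝ} (hr : r ≠ 0) : faceProfile n r r = 1 := by
  have : π / (2 * r) * r = π / 2 := by field_simp
  simp [faceProfile, this]

theorem faceProfile_neg (n : ℕ) (r t : ℝ) : faceProfile n r (-t) = -faceProfile n r t := by
  simp [faceProfile, Odd.neg_pow (⟨n, rfl⟩ : Odd (2 * n + 1))]

theorem abs_faceProfile_le_one (n : ℕ) (r t : ℝ) : |faceProfile n r t| ≤ 1 := by
  rw [faceProfile, abs_pow]
  exact pow_le_one₀ (abs_nonneg _) (abs_sin_le_one _)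

theorem faceProfile_sq_le_one (n : ℕ) (r t : ℝ) : faceProfile n r t ^ 2 ≤ 1 :=
  (sq_le_one_iff_abs_le_one _).2 (abs_faceProfile_le_one n r t)

theorem faceCutoff_nonneg (n : ℕ) (r t : ℝ) : 0 ≤ faceCutoff n r t :=
  sub_nonneg.2 (faceProfile_sq_le_one n r t)

theorem faceCutoff_le_one (n : ℕ) (r t : ℝ) : faceCutoff n r t ≤ 1 :=
  sub_le_self _ (sq_nonneg _)

/-- With `c` the cutoff, the sum is `1 - c + c ^ 2` with `0 ≤ c ≤ 1`. This pointwise bound makes the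
product fields admissible. -/
theorem faceProfile_sq_add_faceCutoff_sq_le_one (n : ℕ) (r t : ℝ) :
    faceProfile n r t ^ 2 + faceCutoff n r t ^ 2 ≤ 1 := by
  have h1 := faceCutoff_nonneg n r t
  have h2 := faceCutoff_le_one n r t
  have : faceProfile n r t ^ 2 = 1 - faceCutoff n r t := by simp [faceCutoff]
  nlinarith

theorem abs_faceProfileDeriv_le (n : ℕ) {r : ℝ} (hr : 0 < r) (t : ℝ) :
    |faceProfileDeriv n r t| ≤ (2 * n + 1) * (π / (2 * r)) := by
  rw [faceProfileDeriv, abs_mul, abs_mul, abs_mul, abs_pow]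
  have h1 : |sin (π / (2 * r) * t)| ^ (2 * n) ≤ 1 := pow_le_one₀ (abs_nonneg _) (abs_sin_le_one _)
  have h2 := abs_cos_le_one (π / (2 * r) * t)
  rw [abs_of_pos (by positivity : (0 : ℝ) < 2 * n + 1), abs_of_pos (by positivity : 0 < π / (2 * r))]
  calc _ ≤ (2 * (n : ℝ) + 1) * 1 * (1 * (π / (2 * r))) := by gcongr
    _ = _ := by ring

/-- Strictly inside the interval the sine has modulus below one, so its powers vanish in the limit.
-/
theorem tendsto_faceCutoff {r t : ℝ} (ht : |t| < r) :
    Tendsto (fun n ↦ faceCutoff n r t) atTop (nhds 1) := by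
  have hr : 0 < r := (abs_nonneg t).trans_lt ht
  have hs : |sin (π / (2 * r) * t)| < 1 := by
    have hlt : |π / (2 * r) * t| < π / 2 := by
      rw [abs_mul, abs_of_pos (by positivity : 0 < π / (2 * r))]
      calc π / (2 * r) * |t| < π / (2 * r) * r := by gcongr
        _ = π / 2 := by field_simp
    have hc := cos_pos_of_mem_Ioo (abs_lt.1 hlt)
    rw [← sq_lt_one_iff_abs_lt_one]
    nlinarith [sin_sq_add_cos_sq (π / (2 * r) * t)]
  have h1 : Tendsto (fun n : ℕ ↦ sin (π / (2 * r) * t) ^ (2 * n + 1)) atTop (nhds 0) :=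
    (tendsto_pow_atTop_nhds_zero_of_abs_lt_one hs).comp
      (tendsto_atTop_mono (fun n ↦ (by omega : n ≤ 2 * n + 1)) tendsto_id)
  simpa [faceCutoff, faceProfile] using (h1.pow 2).const_sub 1

end FaceProfile

/-! ### Boxes in independent Gaussian coordinates -/

section Box

variable {Ω : Type*} {ξ : ℕ → Ω → ℝ}

/-- The event that `|ξ i| ≤ r i` for all `i ∈ S`. -/
def boxEvent (ξ : ℕ → Ω → ℝ) (r : ℕ → ℝ) (S : Set ℕ) : Set Ω := {ω | ∀ i ∈ S, |ξ i ω| ≤ r i}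

theorem boxEvent_union (r : ℕ → ℝ) (S T : Set ℕ) :
    boxEvent ξ r (S ∪ T) = boxEvent ξ r S ∩ boxEvent ξ r T := by
  ext ω; simp only [boxEvent, Set.mem_ofPred_eq, Set.mem_union, Set.mem_inter_iff]; grind

/-- The box in the sequences indexed by `S`. -/
def subBox (r : ℕ → ℝ) (S : Set ℕ) : Set (S → ℝ) := {y | ∀ i : S, |y i| ≤ r i}

theorem boxEvent_eq_preimage (r : ℕ → ℝ) (S : Set ℕ) :
    boxEvent ξ r S = (fun ω (i : S) ↦ ξ i ω) ⁻¹' subBox r S := by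
  ext ω; simp [boxEvent, subBox]

/-- The product of the cutoffs of the coordinates in `s`. -/
noncomputable def cutoffProd (ξ : ℕ → Ω → ℝ) (r : ℕ → ℝ) (n : ℕ) (s : Finset ℕ) (ω : Ω) : ℝ :=
  ∏ j ∈ s, faceCutoff n (r j) (ξ j ω)

theorem cutoffProd_nonneg (r : ℕ → ℝ) (n : ℕ) (s : Finset ℕ) (ω : Ω) :
    0 ≤ cutoffProd ξ r n s ω := Finset.prod_nonneg fun _ _ ↦ faceCutoff_nonneg _ _ _

theorem cutoffProd_le_one (r : ℕ → ℝ) (n : ℕ) (s : Finset ℕ) (ω : Ω) :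
    cutoffProd ξ r n s ω ≤ 1 :=
  Finset.prod_le_one (fun _ _ ↦ faceCutoff_nonneg _ _ _) fun _ _ ↦ faceCutoff_le_one _ _ _

end Box

section Independent

variable {Ω : Type*} [MeasurableSpace Ω] {P : Measure Ω} {ξ : ℕ → Ω → ℝ}

/-- Each block generates the supremum of the σ-algebras of its coordinates; infinite blocks are
allowed, as needed for `{k}ᶜ`. -/
theorem _root_.ProbabilityTheory.iIndepFun.indepFun_of_disjoint {ι : Type*} {ξ : ι → Ω → ℝ}
    (h : iIndepFun ξ P) (hm : ∀ i, Measurable (ξ i)) {S T : Set ι} (hST : Disjoint S T) :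
    IndepFun (fun ω (i : S) ↦ ξ i ω) (fun ω (i : T) ↦ ξ i ω) P := by
  have hcomap : ∀ S : Set ι, MeasurableSpace.comap (fun ω (i : S) ↦ ξ i ω) MeasurableSpace.pi =
      ⨆ i ∈ S, MeasurableSpace.comap (ξ i) inferInstance := fun S ↦ by
    simp_rw [MeasurableSpace.pi, MeasurableSpace.comap_iSup, MeasurableSpace.comap_comp,
      Function.comp_def, iSup_subtype]
  rw [IndepFun_iff_Indep, hcomap, hcomap]
  exact indep_iSup_of_disjoint (fun i ↦ (hm i).comap_le) h.iIndep hST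

theorem measurableSet_boxEvent (hm : ∀ i, Measurable (ξ i)) (r : ℕ → ℝ) (S : Set ℕ) :
    MeasurableSet (boxEvent ξ r S) := by
  have : boxEvent ξ r S = ⋂ i ∈ S, {ω | |ξ i ω| ≤ r i} := by ext; simp [boxEvent]
  rw [this]
  exact .biInter S.to_countable fun i _ ↦ measurableSet_le (by have := hm i; fun_prop) (by fun_prop)

theorem measurableSet_subBox (r : ℕ → ℝ) (S : Set ℕ) : MeasurableSet (subBox r S) := by
  have : subBox r S = ⋂ i : S, {y | |y i| ≤ r i} := by ext; simp [subBox]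
  rw [this]
  exact .iInter fun i ↦ measurableSet_le (by fun_prop) (by fun_prop)

theorem measure_boxEvent_union (hi : iIndepFun ξ P) (hm : ∀ i, Measurable (ξ i)) (r : ℕ → ℝ)
    {S T : Set ℕ} (hST : Disjoint S T) :
    P (boxEvent ξ r (S ∪ T)) = P (boxEvent ξ r S) * P (boxEvent ξ r T) := by
  rw [boxEvent_union, boxEvent_eq_preimage, boxEvent_eq_preimage]
  exact (hi.indepFun_of_disjoint hm hST).measure_inter_preimage_eq_mul _ _
    (measurableSet_subBox r S) (measurableSet_subBox r T)

theorem measure_abs_le_pos (hm : ∀ i, Measurable (ξ i))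
    (hlaw : ∀ i, P.map (ξ i) = gaussianReal 0 1) {r : ℕ → ℝ} (hr : ∀ i, 0 < r i) (i : ℕ) :
    0 < P {ω | |ξ i ω| ≤ r i} := by
  have : {ω | |ξ i ω| ≤ r i} = ξ i ⁻¹' Set.Icc (-r i) (r i) := by ext; simp [abs_le]
  rw [this, ← Measure.map_apply (hm i) measurableSet_Icc, hlaw, pos_iff_ne_zero]
  intro h0
  have := gaussianReal_absolutelyContinuous' 0 one_ne_zero h0
  rw [Real.volume_Icc, ENNReal.ofReal_eq_zero] at this
  linarith [hr i]

/-- The Gaussian measure of a box is positive if the measures of the complements of the slabs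
are summable. -/
theorem measure_boxEvent_univ_pos [IsProbabilityMeasure P] (hi : iIndepFun ξ P)
    (hm : ∀ i, Measurable (ξ i)) (hlaw : ∀ i, P.map (ξ i) = gaussianReal 0 1) {r : ℕ → ℝ}
    (hr : ∀ i, 0 < r i)
    (hs : Summable fun i ↦ (gaussianReal 0 1).real (Set.Icc (-r i) (r i))ᶜ) :
    0 < P (boxEvent ξ r Set.univ) := by
  classical
  have hhead : ∀ n : ℕ, 0 < P (boxEvent ξ r (Set.Iio n)) := by
    intro n
    induction n with
    | zero => simp [boxEvent]
    | succ n ih =>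
      have h1 : Set.Iio (n + 1) = Set.Iio n ∪ {n} := by ext; simp
      rw [h1, measure_boxEvent_union hi hm r (by simp)]
      refine ENNReal.mul_pos ih.ne' (ne_of_gt ?_)
      simpa [boxEvent] using measure_abs_le_pos hm hlaw hr n
  -- Far enough out, the sum of the tails is below one, so the union bound suffices; the finitely
  -- many slabs left are handled by `hhead`.
  have htail : ∃ n : ℕ, 0 < P (boxEvent ξ r (Set.Ici n)) := by
    have hcompl : ∀ n, (boxEvent ξ r (Set.Ici n))ᶜ =
        ⋃ i : ℕ, ξ (i + n) ⁻¹' (Set.Icc (-r (i + n)) (r (i + n)))ᶜ := fun n ↦ by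
      ext ω
      simp only [boxEvent, Set.mem_compl_iff, Set.mem_ofPred_eq, Set.mem_iUnion, Set.mem_preimage,
        Set.mem_Icc, ← abs_le, Set.mem_Ici, not_forall]
      exact ⟨fun ⟨i, hi, h⟩ ↦ ⟨i - n, by rwa [Nat.sub_add_cancel hi]⟩,
        fun ⟨i, h⟩ ↦ ⟨i + n, by omega, h⟩⟩
    obtain ⟨q, hq⟩ : ∃ q : ℕ → ℝ, ∀ i, (gaussianReal 0 1).real (Set.Icc (-r i) (r i))ᶜ = q i :=
      ⟨_, fun _ ↦ rfl⟩
    simp_rw [hq] at hs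
    have hlim := tendsto_sum_nat_add q
    obtain ⟨n, hn⟩ := (hlim.eventually (gt_mem_nhds one_pos)).exists
    refine ⟨n, ?_⟩
    rw [pos_iff_ne_zero]
    intro h0
    have h1 : P (boxEvent ξ r (Set.Ici n))ᶜ = 1 :=
      (prob_compl_eq_one_iff (measurableSet_boxEvent hm r _)).2 h0
    have h2 : P (boxEvent ξ r (Set.Ici n))ᶜ ≤
        ENNReal.ofReal (∑' i, q (i + n)) := by
      rw [hcompl, ENNReal.ofReal_tsum_of_nonneg (fun i ↦ hq (i + n) ▸ measureReal_nonneg)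
        ((summable_nat_add_iff n).2 hs)]
      refine (measure_iUnion_le _).trans (ENNReal.tsum_le_tsum fun i ↦ ?_)
      rw [← Measure.map_apply (hm _) measurableSet_Icc.compl, hlaw, ← hq, ofReal_measureReal]
    rw [h1, ENNReal.one_le_ofReal] at h2
    exact absurd h2 (not_le.2 hn)
  obtain ⟨n, hn⟩ := htail
  rw [← Set.Iio_union_Ici (a := n), measure_boxEvent_union hi hm r
    (Set.Iio_disjoint_Ici le_rfl)]
  exact ENNReal.mul_pos (hhead n).ne' hn.ne'

theorem measurable_cutoffProd (hm : ∀ i, Measurable (ξ i)) (r : ℕ → ℝ) (n : ℕ) (s : Finset ℕ) :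
    Measurable (cutoffProd ξ r n s) :=
  Finset.measurable_fun_prod _ fun j _ ↦ (continuous_faceCutoff n (r j)).measurable.comp (hm j)

/-- The integrand cut off to the box is a function of `ξ k` times a function of the other
coordinates, so the integral factors. The first factor is computed by parts; the profile is `±1` at
the ends, whence the 2. -/
theorem setIntegral_box_face (hi : iIndepFun ξ P)
    (hm : ∀ i, Measurable (ξ i)) (hlaw : ∀ i, P.map (ξ i) = gaussianReal 0 1) {r : ℕ → ℝ}
    (hr : ∀ i, 0 < r i) (n k : ℕ) (s : Finset ℕ) (hk : k ∉ s) :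
    ∫ ω in boxEvent ξ r Set.univ,
      (faceProfileDeriv n (r k) (ξ k ω) - ξ k ω * faceProfile n (r k) (ξ k ω)) *
        cutoffProd ξ r n s ω ∂P =
    2 * gaussianPDFReal 0 1 (r k) *
      ∫ ω in boxEvent ξ r {k}ᶜ, cutoffProd ξ r n s ω ∂P := by
  classical
  have hs : ∀ j ∈ s, j ∈ ({k}ᶜ : Set ℕ) := fun j hj h ↦ hk (h ▸ hj)
  let F : ℝ → ℝ := (Set.Icc (-r k) (r k)).indicator
    fun t ↦ faceProfileDeriv n (r k) t - t * faceProfile n (r k) t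
  let G : (({k}ᶜ : Set ℕ) → ℝ) → ℝ := (subBox r {k}ᶜ).indicator
    fun y ↦ ∏ j ∈ s.attach, faceCutoff n (r j) (y ⟨j, hs j j.2⟩)
  have hF : Measurable F := by
    refine Measurable.indicator ?_ measurableSet_Icc
    exact ((continuous_faceProfileDeriv n (r k)).sub
      (continuous_id.mul (continuous_faceProfile n (r k)))).measurable
  have hG : Measurable G := by
    refine Measurable.indicator ?_ (measurableSet_subBox _ _)
    exact Finset.measurable_fun_prod _ fun j _ ↦
      (continuous_faceCutoff n (r j)).measurable.comp (measurable_pi_apply _)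
  have hind : IndepFun (fun ω ↦ F (ξ k ω)) (fun ω ↦ G fun i ↦ ξ i ω) P :=
    (hi.indepFun_of_disjoint hm (S := {k}) (T := {k}ᶜ) disjoint_compl_right).comp
      (φ := fun y : ({k} : Set ℕ) → ℝ ↦ F (y ⟨k, rfl⟩)) (ψ := G)
      (hF.comp (measurable_pi_apply _)) hG
  have hGeq : ∀ ω, G (fun i ↦ ξ i ω) =
      (boxEvent ξ r {k}ᶜ).indicator (cutoffProd ξ r n s) ω := fun ω ↦ by
    have hprod : ∏ j ∈ s.attach, faceCutoff n (r j) (ξ j ω) = cutoffProd ξ r n s ω :=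
      Finset.prod_attach s fun j ↦ faceCutoff n (r j) (ξ j ω)
    rw [boxEvent_eq_preimage]
    simp only [G, Set.indicator, Set.mem_preimage, hprod]
  have hprod : ∀ ω, F (ξ k ω) * G (fun i ↦ ξ i ω) =
      (boxEvent ξ r Set.univ).indicator (fun ω ↦
        (faceProfileDeriv n (r k) (ξ k ω) - ξ k ω * faceProfile n (r k) (ξ k ω)) *
        cutoffProd ξ r n s ω) ω := fun ω ↦ by
    have hb : ω ∈ boxEvent ξ r Set.univ ↔
        ξ k ω ∈ Set.Icc (-r k) (r k) ∧ ω ∈ boxEvent ξ r {k}ᶜ := by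
      rw [← Set.union_compl_self {k}, boxEvent_union, Set.mem_inter_iff]
      simp [boxEvent, abs_le]
    rw [hGeq]
    by_cases h1 : ξ k ω ∈ Set.Icc (-r k) (r k) <;> by_cases h2 : ω ∈ boxEvent ξ r {k}ᶜ
    · rw [Set.indicator_of_mem (hb.2 ⟨h1, h2⟩), Set.indicator_of_mem h2]
      simp only [F, Set.indicator_of_mem h1]
    all_goals
      rw [Set.indicator_of_notMem (s := boxEvent ξ r Set.univ) (fun h ↦ by tauto)]
      simp [F, h1, h2]
  rw [← integral_indicator (measurableSet_boxEvent hm r _), ← integral_congr_ae (.of_forall hprod),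
    hind.integral_fun_mul_eq_mul_integral (hF.comp (hm k)).aestronglyMeasurable
      (hG.comp (measurable_pi_lambda _ fun i ↦ hm i)).aestronglyMeasurable,
    integral_congr_ae (.of_forall hGeq), integral_indicator (measurableSet_boxEvent hm r _),
    ← integral_map (f := F) (hm k).aemeasurable hF.aestronglyMeasurable, hlaw,
    integral_indicator measurableSet_Icc,
    setIntegral_deriv_sub_mul_gaussianReal (hr k).le (hasDerivAt_faceProfile n (r k))
      (continuous_faceProfileDeriv n (r k)), faceProfile_neg, faceProfile_self n (hr k).ne']
  norm_num

/-- Dominated convergence, after discarding the null set where some `|ξ i| = r i`. -/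
theorem tendsto_setIntegral_cutoffProd [IsFiniteMeasure P]
    (hm : ∀ i, Measurable (ξ i)) (hlaw : ∀ i, P.map (ξ i) = gaussianReal 0 1) (r : ℕ → ℝ)
    (S : Set ℕ) (s : Finset ℕ) (hs : ↑s ⊆ S) :
    Tendsto (fun n ↦ ∫ ω in boxEvent ξ r S, cutoffProd ξ r n s ω ∂P) atTop
      (nhds (P.real (boxEvent ξ r S))) := by
  have hne : ∀ᵐ ω ∂P, ∀ i, |ξ i ω| ≠ r i := by
    rw [ae_all_iff]
    intro i
    have hnull : gaussianReal 0 1 {-r i, r i} = 0 :=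
      gaussianReal_absolutelyContinuous 0 one_ne_zero ((Set.toFinite _).measure_zero _)
    rw [← hlaw i, Measure.map_apply (hm i) (Set.toFinite _).measurableSet] at hnull
    refine measure_mono_null (fun ω hω ↦ ?_) hnull
    simp only [ne_eq, Set.mem_compl_iff, Set.mem_ofPred_eq, not_not] at hω
    rcases abs_choice (ξ i ω) with h | h <;> rw [h] at hω
    · exact Or.inr hω
    · exact Or.inl (by linarith)
  have h := tendsto_integral_of_dominated_convergence (μ := P.restrict (boxEvent ξ r S))
    (F := fun n ↦ cutoffProd ξ r n s) (f := fun _ ↦ 1) (fun _ ↦ (1 : ℝ))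
    (fun n ↦ (measurable_cutoffProd hm r n s).aestronglyMeasurable) (integrable_const _)
    (fun n ↦ .of_forall fun ω ↦ by
      rw [Real.norm_of_nonneg (cutoffProd_nonneg ..)]; exact cutoffProd_le_one ..)
    (by
      filter_upwards [ae_restrict_of_ae hne, ae_restrict_mem (measurableSet_boxEvent hm r S)]
        with ω h1 h2
      rw [← Finset.prod_const_one (s := s)]
      exact tendsto_finsetProd _ fun j hj ↦
        tendsto_faceCutoff (lt_of_le_of_ne (h2 j (hs hj)) (h1 j)))
  simpa using h

end Independent

/-! ### Cylindrical functions and a product inequality -/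

section Cylindrical

/-- Bounded `C¹` functions with bounded derivative. -/
structure IsC1b {m : ℕ} (φ : (Fin m → ℝ) → ℝ) : Prop where
  contDiff : ContDiff ℝ 1 φ
  bdd : ∃ M : ℝ, ∀ y, |φ y| ≤ M
  bdd_fderiv : ∃ M : ℝ, ∀ y, ‖fderiv ℝ φ y‖ ≤ M

namespace IsC1b

variable {m : ℕ} {φ ψ : (Fin m → ℝ) → ℝ}

theorem const (c : ℝ) : IsC1b fun _ : Fin m → ℝ ↦ c :=
  ⟨contDiff_const, ⟨|c|, fun _ ↦ le_rfl⟩, ⟨0, fun y ↦ by simp⟩⟩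

theorem mul (hφ : IsC1b φ) (hψ : IsC1b ψ) : IsC1b fun y ↦ φ y * ψ y := by
  obtain ⟨A, hA⟩ := hφ.bdd
  obtain ⟨A', hA'⟩ := hφ.bdd_fderiv
  obtain ⟨B, hB⟩ := hψ.bdd
  obtain ⟨B', hB'⟩ := hψ.bdd_fderiv
  have hA0 : 0 ≤ A := (abs_nonneg _).trans (hA 0)
  have hB0 : 0 ≤ B := (abs_nonneg _).trans (hB 0)
  refine ⟨hφ.contDiff.mul hψ.contDiff, ⟨A * B, fun y ↦ ?_⟩, ⟨A * B' + B * A', fun y ↦ ?_⟩⟩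
  · rw [abs_mul]; exact mul_le_mul (hA y) (hB y) (abs_nonneg _) hA0
  · rw [fderiv_fun_mul (hφ.contDiff.differentiable one_ne_zero y)
      (hψ.contDiff.differentiable one_ne_zero y)]
    refine (norm_add_le _ _).trans (add_le_add ?_ ?_) <;> rw [norm_smul]
    · exact mul_le_mul (hA y) (hB' y) (norm_nonneg _) hA0
    · exact mul_le_mul (hB y) (hA' y) (norm_nonneg _) hB0

theorem pow (hφ : IsC1b φ) (n : ℕ) : IsC1b fun y ↦ φ y ^ n := by
  induction n with
  | zero => simpa using const 1
  | succ n ih => simpa [pow_succ] using ih.mul hφ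

theorem const_sub (hφ : IsC1b φ) (c : ℝ) : IsC1b fun y ↦ c - φ y := by
  obtain ⟨A, hA⟩ := hφ.bdd
  obtain ⟨A', hA'⟩ := hφ.bdd_fderiv
  refine ⟨contDiff_const.sub hφ.contDiff, ⟨|c| + A, fun y ↦ ?_⟩, ⟨A', fun y ↦ ?_⟩⟩
  · exact (abs_sub _ _).trans (by gcongr; exact hA y)
  · rw [fderiv_const_sub, norm_neg]; exact hA' y

theorem prod {ι : Type*} (s : Finset ι) {φ : ι → (Fin m → ℝ) → ℝ} (h : ∀ i, IsC1b (φ i)) :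
    IsC1b fun y ↦ ∏ i ∈ s, φ i y := by
  classical
  induction s using Finset.induction_on with
  | empty => simpa using const 1
  | insert i s hi ih => simpa [Finset.prod_insert hi] using (h i).mul ih

theorem sin_apply (c : ℝ) (j : Fin m) : IsC1b fun y ↦ Real.sin (c * y j) := by
  refine ⟨by fun_prop, ⟨1, fun y ↦ Real.abs_sin_le_one _⟩, ⟨‖c • ContinuousLinearMap.proj (R := ℝ)
    (φ := fun _ : Fin m ↦ ℝ) j‖, fun y ↦ ?_⟩⟩
  have h : HasFDerivAt (fun y : Fin m → ℝ ↦ c * y j)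
      (c • ContinuousLinearMap.proj (R := ℝ) (φ := fun _ : Fin m ↦ ℝ) j) y :=
    (hasFDerivAt_apply j y).const_mul c
  rw [h.sin.fderiv, norm_smul]
  exact mul_le_of_le_one_left (norm_nonneg _) (Real.abs_cos_le_one _)

theorem faceProfile_apply (n : ℕ) (r : ℝ) (j : Fin m) : IsC1b fun y ↦ faceProfile n r (y j) :=
  (sin_apply _ j).pow _

theorem faceCutoff_apply (n : ℕ) (r : ℝ) (j : Fin m) : IsC1b fun y ↦ faceCutoff n r (y j) :=
  ((faceProfile_apply n r j).pow 2).const_sub 1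

end IsC1b

theorem IsC1b.isCylindricalC1b {X : Type*} [NormedAddCommGroup X] [NormedSpace ℝ X]
    {m : ℕ} {φ : (Fin m → ℝ) → ℝ} (hφ : IsC1b φ) (L : Fin m → StrongDual ℝ X) :
    IsCylindricalC1b fun x ↦ φ fun i ↦ L i x :=
  ⟨m, L, φ, hφ.contDiff, hφ.bdd, hφ.bdd_fderiv, rfl⟩

/-- The terms of degree at most one in the `a i` in the expansion of `∏ (a i + b i)`. -/
theorem sum_mul_prod_erase_add_prod_le {ι : Type*} [DecidableEq ι] (s : Finset ι) {a b : ι → ℝ}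
    (ha : ∀ i, 0 ≤ a i) (hb : ∀ i, 0 ≤ b i) :
    ∑ k ∈ s, a k * ∏ j ∈ s.erase k, b j + ∏ j ∈ s, b j ≤ ∏ j ∈ s, (a j + b j) := by
  induction s using Finset.induction_on with
  | empty => simp
  | insert i s hi ih =>
    rw [Finset.sum_insert hi, Finset.prod_insert hi, Finset.prod_insert hi,
      Finset.erase_insert hi]
    have h : ∑ k ∈ s, a k * ∏ j ∈ (insert i s).erase k, b j =
        b i * ∑ k ∈ s, a k * ∏ j ∈ s.erase k, b j := by
      rw [Finset.mul_sum]
      refine Finset.sum_congr rfl fun k hk ↦ ?_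
      rw [Finset.erase_insert_of_ne (fun h ↦ hi (by rwa [h])),
        Finset.prod_insert fun h ↦ hi (Finset.mem_of_mem_erase h)]
      ring
    rw [h]
    have h1 : 0 ≤ ∑ k ∈ s, a k * ∏ j ∈ s.erase k, b j :=
      Finset.sum_nonneg fun k _ ↦ mul_nonneg (ha k) (Finset.prod_nonneg fun j _ ↦ hb j)
    -- Only `a i` times the sum over `s` is lost; it is nonnegative by `h1`.
    have h2 := mul_le_mul_of_nonneg_left ih (add_nonneg (ha i) (hb i))
    nlinarith [mul_nonneg (ha i) h1]

end Cylindrical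

/-! ### Normalized coordinates and the Cameron-Martin basis -/

section Coordinates

variable {X : Type*} [NormedAddCommGroup X] [InnerProductSpace ℝ X]

open scoped RealInnerProductSpace

/-- The coordinate functionals normalized by the square roots of the eigenvalues. -/
noncomputable def coord (e : HilbertBasis ℕ ℝ X) (lam : ℕ → ℝ) (j : ℕ) : StrongDual ℝ X :=
  (√(lam j))⁻¹ • innerSL ℝ (e j)

theorem coord_apply (e : HilbertBasis ℕ ℝ X) (lam : ℕ → ℝ) (j : ℕ) (x : X) :
    coord e lam j x = (√(lam j))⁻¹ * ⟪x, e j⟫ := by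
  simp [coord, real_inner_comm]

theorem hilbertCube_eq_boxEvent (e : HilbertBasis ℕ ℝ X) {lam : ℕ → ℝ} (hlam : ∀ j, 0 < lam j)
    (r : ℕ → ℝ) : hilbertCube e (fun k ↦ √(lam k) * r k) =
      boxEvent (fun j ↦ coord e lam j) r Set.univ := by
  ext x
  simp only [hilbertCube, boxEvent, Set.mem_ofPred_eq, Set.mem_univ, true_imp_iff, coord_apply]
  refine forall_congr' fun k ↦ ?_
  have := Real.sqrt_pos.2 (hlam k)
  rw [abs_mul, abs_of_pos (inv_pos.2 this), inv_mul_le_iff₀ this]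

variable [MeasurableSpace X] [BorelSpace X]
  {γ : Measure X} [IsGaussian γ] {e : HilbertBasis ℕ ℝ X} {lam : ℕ → ℝ}

theorem memLp_coord (j : ℕ) : MemLp (coord e lam j) 2 γ :=
  IsGaussian.memLp_dual γ _ 2 (by simp)

variable [CompleteSpace X] [SecondCountableTopology X]

theorem IsEigensystem.lam_pos (he : IsEigensystem γ e lam) (hc : ∫ x, x ∂γ = 0)
    (hnd : IsNondegenerate γ) (j : ℕ) : 0 < lam j := by
  have h := inner_covOp_self_pos γ hc hnd (e.orthonormal.ne_zero j)
  rwa [he.eigen, real_inner_smul_left, real_inner_self_eq_norm_sq, e.orthonormal.1 j, one_pow,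
    mul_one] at h

theorem IsEigensystem.integral_coord_mul_coord (he : IsEigensystem γ e lam)
    (hlam : ∀ j, 0 < lam j) (i j : ℕ) :
    ∫ x, coord e lam i x * coord e lam j x ∂γ = if i = j then 1 else 0 := by
  have h := inner_covOp γ IsGaussian.memLp_two_id (e i) (e j)
  rw [he.eigen, real_inner_smul_left, orthonormal_iff_ite.1 e.orthonormal] at h
  have h2 : ∀ x, coord e lam i x * coord e lam j x =
      (√(lam i))⁻¹ * (√(lam j))⁻¹ * (⟪x, e i⟫ * ⟪x, e j⟫) := fun x ↦ by
    rw [coord_apply, coord_apply]; ring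
  simp_rw [h2]
  rw [integral_const_mul, ← h]
  split_ifs with hij
  · subst hij
    rw [← mul_inv, Real.mul_self_sqrt (hlam i).le, mul_one, inv_mul_cancel₀ (hlam i).ne']
  · simp

theorem integral_coord (hc : ∫ x, x ∂γ = 0) (j : ℕ) : ∫ x, coord e lam j x ∂γ = 0 := by
  rw [IsGaussian.integral_dual, hc, map_zero]

theorem IsEigensystem.map_coord (he : IsEigensystem γ e lam) (hc : ∫ x, x ∂γ = 0)
    (hlam : ∀ j, 0 < lam j) (j : ℕ) : γ.map (coord e lam j) = gaussianReal 0 1 := by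
  rw [IsGaussian.map_eq_gaussianReal, integral_coord hc,
    variance_of_integral_eq_zero (by fun_prop) (integral_coord hc j)]
  have := he.integral_coord_mul_coord hlam j j
  simp_rw [← sq] at this
  simp [this]

/-- Jointly Gaussian and uncorrelated variables are independent. -/
theorem IsEigensystem.iIndepFun_coord (he : IsEigensystem γ e lam) (hc : ∫ x, x ∂γ = 0)
    (hlam : ∀ j, 0 < lam j) : iIndepFun (fun j x ↦ coord e lam j x) γ := by
  rw [iIndepFun_iff_finset]
  intro s
  refine HasGaussianLaw.iIndepFun_of_covariance_eq_zero
    (X := s.restrict fun j x ↦ coord e lam j x) ?_ fun i j hij ↦ ?_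
  · exact IsGaussian.hasGaussianLaw_id.map (ContinuousLinearMap.pi fun i : s ↦ coord e lam i)
  · simp only [Finset.restrict]
    rw [covariance_eq_sub (memLp_coord _) (memLp_coord _), integral_coord hc, zero_mul, sub_zero]
    refine (he.integral_coord_mul_coord hlam i j).trans (if_neg fun h ↦ hij (Subtype.ext h))

/-- The vector `√(lam j) e j` of the Cameron-Martin space. -/
noncomputable def cmCoord (γ : Measure X) (e : HilbertBasis ℕ ℝ X) (lam : ℕ → ℝ) (j : ℕ) :
    CameronMartin γ :=
  ⟨(coord e lam j).toLp γ 2, Submodule.le_topologicalClosure _ ⟨coord e lam j, rfl⟩⟩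

theorem coeFn_cmCoord (j : ℕ) :
    ((cmCoord γ e lam j : Lp ℝ 2 γ) : X → ℝ) =ᵐ[γ] coord e lam j := by
  have h : (cmCoord γ e lam j : Lp ℝ 2 γ) = MemLp.toLp (coord e lam j) (memLp_coord j) :=
    StrongDual.toLp_apply IsGaussian.memLp_two_id _
  rw [h]
  exact MemLp.coeFn_toLp _

theorem IsEigensystem.orthonormal_cmCoord (he : IsEigensystem γ e lam) (hlam : ∀ j, 0 < lam j) :
    Orthonormal ℝ (cmCoord γ e lam) := by
  rw [orthonormal_iff_ite]
  intro i j
  rw [Submodule.coe_inner, L2.inner_def, ← he.integral_coord_mul_coord hlam]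
  refine integral_congr_ae ?_
  filter_upwards [coeFn_cmCoord (γ := γ) (e := e) (lam := lam) i,
    coeFn_cmCoord (γ := γ) (e := e) (lam := lam) j] with x hi hj
  simp [hi, hj, mul_comm]

theorem IsEigensystem.cmEmbed_cmCoord (he : IsEigensystem γ e lam) (hlam : ∀ j, 0 < lam j)
    (j : ℕ) : cmEmbed γ (cmCoord γ e lam j) = √(lam j) • e j := by
  have h : cmEmbed γ (cmCoord γ e lam j) = ∫ x, (√(lam j))⁻¹ • (⟪x, e j⟫ • x) ∂γ := by
    refine integral_congr_ae ?_
    filter_upwards [coeFn_cmCoord (γ := γ) (e := e) (lam := lam) j] with x hx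
    rw [hx, coord_apply, mul_smul]
  rw [h, integral_smul]
  change (√(lam j))⁻¹ • covOp γ (e j) = _
  rw [he.eigen, smul_smul]
  congr 1
  have := Real.sqrt_pos.2 (hlam j)
  rw [inv_mul_eq_iff_eq_mul₀ this.ne', Real.mul_self_sqrt (hlam j).le]

end Coordinates

/-! ### Topology of Hilbert cubes -/

section HilbertCube

variable {X : Type*} [NormedAddCommGroup X] [InnerProductSpace ℝ X]

open scoped RealInnerProductSpace

theorem hilbertCube_eq_iInter (e : HilbertBasis ℕ ℝ X) (a : ℕ → ℝ) :
    hilbertCube e a = ⋂ k, innerSL ℝ (e k) ⁻¹' Set.Icc (-a k) (a k) := by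
  ext x
  simp [hilbertCube, abs_le, real_inner_comm]

theorem isClosed_hilbertCube (e : HilbertBasis ℕ ℝ X) (a : ℕ → ℝ) :
    IsClosed (hilbertCube e a) := by
  rw [hilbertCube_eq_iInter]
  exact isClosed_iInter fun k ↦ isClosed_Icc.preimage (innerSL ℝ (e k)).continuous

theorem convex_hilbertCube (e : HilbertBasis ℕ ℝ X) (a : ℕ → ℝ) :
    Convex ℝ (hilbertCube e a) := by
  rw [hilbertCube_eq_iInter]
  exact convex_iInter fun k ↦ (convex_Icc _ _).linear_preimage (innerSL ℝ (e k)).toLinearMap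

/-- A Hilbert cube with square summable side lengths is compact. -/
theorem isCompact_hilbertCube (e : HilbertBasis ℕ ℝ X) {a : ℕ → ℝ}
    (ha : Summable fun k ↦ a k ^ 2) : IsCompact (hilbertCube e a) := by
  let K : Set (ℕ → ℝ) := Set.univ.pi fun k ↦ Set.Icc (-a k) (a k)
  have hK : IsCompact K := isCompact_univ_pi fun k ↦ isCompact_Icc
  have hKsq : ∀ c ∈ K, ∀ k, c k ^ 2 ≤ a k ^ 2 := fun c hc k ↦
    sq_le_sq' (hc k trivial).1 (hc k trivial).2
  have hmem : ∀ c ∈ K, Memℓp c 2 := fun c hc ↦ memℓp_gen <| by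
    simpa using ha.of_nonneg_of_le (fun k ↦ sq_nonneg _) (hKsq c hc)
  -- The cube is the image of the Tychonoff-compact `K`. On `K` pointwise convergence implies `ℓ²`
  -- convergence, since `4 * a k ^ 2` dominates the squared differences.
  let G : K → lp (fun _ : ℕ ↦ ℝ) 2 := fun c ↦ ⟨c.1, hmem c.1 c.2⟩
  have hG : Continuous G := by
    refine continuous_iff_continuousAt.2 fun c₀ ↦ ?_
    rw [ContinuousAt, tendsto_iff_norm_sub_tendsto_zero]
    have hsq : ∀ c, ‖G c - G c₀‖ ^ 2 = ∑' k, (c.1 k - c₀.1 k) ^ 2 := fun c ↦ by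
      rw [← real_inner_self_eq_norm_sq, lp.inner_eq_tsum]
      refine tsum_congr fun k ↦ ?_
      simp [G, sq]
      rfl
    have hlim : Tendsto (fun c ↦ ‖G c - G c₀‖ ^ 2) (nhds c₀) (nhds 0) := by
      simp_rw [hsq]
      have h := tendsto_tsum_of_dominated_convergence (𝓕 := nhds c₀)
        (f := fun c : K ↦ fun k ↦ (c.1 k - c₀.1 k) ^ 2) (g := fun _ ↦ 0)
        (bound := fun k ↦ 4 * a k ^ 2) (ha.mul_left 4)
        (fun k ↦ by
          have : Continuous fun c : K ↦ (c.1 k - c₀.1 k) ^ 2 :=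
            (((continuous_apply k).comp continuous_subtype_val).sub continuous_const).pow 2
          simpa using this.tendsto c₀)
        (.of_forall fun c k ↦ by
          rw [Real.norm_of_nonneg (sq_nonneg _)]
          nlinarith [hKsq c.1 c.2 k, hKsq c₀.1 c₀.2 k, sq_nonneg (c.1 k + c₀.1 k)])
      simpa using h
    simpa using hlim.sqrt
  have hrange : hilbertCube e a = Set.range fun c ↦ e.repr.symm (G c) := by
    ext x
    constructor
    · intro hx
      refine ⟨⟨e.repr x, fun k _ ↦ ?_⟩, ?_⟩
      · rw [e.repr_apply_apply, real_inner_comm]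
        exact abs_le.1 (hx k)
      · exact e.repr.symm_apply_apply x
    · rintro ⟨c, rfl⟩ k
      rw [real_inner_comm, ← e.repr_apply_apply, e.repr.apply_symm_apply]
      exact abs_le.2 (c.2 k trivial)
  have := isCompact_iff_compactSpace.1 hK
  rw [hrange]
  exact isCompact_range (e.repr.symm.continuous.comp hG)

end HilbertCube

/-! ### Test fields and the infinite perimeter -/

section Perimeter

variable {X : Type*} [NormedAddCommGroup X] [InnerProductSpace ℝ X]

/-- The components of a field that, for large `n`, approximates the outer normal on the first `N`
pairs of faces of the cube. -/
noncomputable def faceField (e : HilbertBasis ℕ ℝ X) (lam r : ℕ → ℝ) (n N : ℕ) (k : Fin N) (x : X) :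
    ℝ :=
  faceProfile n (r k) (coord e lam k x) *
    ∏ j ∈ Finset.univ.erase k, faceCutoff n (r j) (coord e lam j x)

theorem isCylindricalC1b_faceField (e : HilbertBasis ℕ ℝ X) (lam r : ℕ → ℝ) (n N : ℕ)
    (k : Fin N) : IsCylindricalC1b (faceField e lam r n N k) :=
  ((IsC1b.faceProfile_apply n (r k) k).mul
    (IsC1b.prod _ fun j : Fin N ↦ IsC1b.faceCutoff_apply n (r j) j)).isCylindricalC1b
      fun i ↦ coord e lam i

theorem IsCylindricalC1b.differentiable {f : X → ℝ} (hf : IsCylindricalC1b f) :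
    Differentiable ℝ f := by
  obtain ⟨m, L, φ, hφ, -, -, rfl⟩ := hf
  exact (hφ.differentiable one_ne_zero).comp (by fun_prop)

/-- The squared components are among the terms of the expanded product of `profile ^ 2 + cutoff ^
2`, each factor of which is at most one. -/
theorem sum_faceField_sq_le_one (e : HilbertBasis ℕ ℝ X) (lam r : ℕ → ℝ) (n N : ℕ) (x : X) :
    ∑ k, faceField e lam r n N k x ^ 2 ≤ 1 := by
  have h := sum_mul_prod_erase_add_prod_le (Finset.univ : Finset (Fin N))
    (a := fun k ↦ faceProfile n (r k) (coord e lam k x) ^ 2)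
    (b := fun k ↦ faceCutoff n (r k) (coord e lam k x) ^ 2)
    (fun _ ↦ sq_nonneg _) (fun _ ↦ sq_nonneg _)
  have h1 : ∏ k : Fin N, (faceProfile n (r k) (coord e lam k x) ^ 2 +
      faceCutoff n (r k) (coord e lam k x) ^ 2) ≤ 1 :=
    Finset.prod_le_one (fun _ _ ↦ by positivity)
      fun _ _ ↦ faceProfile_sq_add_faceCutoff_sq_le_one _ _ _
  have h2 : 0 ≤ ∏ k : Fin N, faceCutoff n (r k) (coord e lam k x) ^ 2 :=
    Finset.prod_nonneg fun _ _ ↦ sq_nonneg _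
  simp_rw [faceField, mul_pow, ← Finset.prod_pow]
  linarith

/-- Moving by `t` along `√(lam k) • e k` adds `t` to the k-th normalized coordinate and fixes the
others, so the cutoffs stay constant. -/
theorem fderiv_faceField (e : HilbertBasis ℕ ℝ X) {lam : ℕ → ℝ} (hlam : ∀ j, 0 < lam j)
    (r : ℕ → ℝ) (n N : ℕ) (k : Fin N) (x : X) :
    fderiv ℝ (faceField e lam r n N k) x (√(lam k) • e k) =
      faceProfileDeriv n (r k) (coord e lam k x) *
        ∏ j ∈ Finset.univ.erase k, faceCutoff n (r j) (coord e lam j x) := by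
  have hcoord : ∀ j : Fin N, coord e lam j (√(lam k) • e k) = if j = k then 1 else 0 := fun j ↦ by
    rw [coord_apply, real_inner_smul_left, orthonormal_iff_ite.1 e.orthonormal]
    by_cases h : j = k
    · subst h
      simp [(Real.sqrt_pos.2 (hlam j)).ne']
    · have : (k : ℕ) ≠ j := fun h' ↦ h (Fin.ext h'.symm)
      simp [h, this]
  rw [← ((isCylindricalC1b_faceField e lam r n N k).differentiable x).lineDeriv_eq_fderiv]
  have hline : ∀ t : ℝ, faceField e lam r n N k (x + t • (√(lam k) • e k)) =
      faceProfile n (r k) (coord e lam k x + t) *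
        ∏ j ∈ Finset.univ.erase k, faceCutoff n (r j) (coord e lam j x) := fun t ↦ by
    unfold faceField
    congr 1
    · rw [map_add, map_smul, hcoord, if_pos rfl, smul_eq_mul, mul_one]
    · refine Finset.prod_congr rfl fun j hj ↦ ?_
      rw [map_add, map_smul, hcoord, if_neg (Finset.ne_of_mem_erase hj), smul_zero, add_zero]
  rw [lineDeriv, funext hline]
  have h := (hasDerivAt_faceProfile n (r k) (coord e lam k x + 0)).comp_const_add
    (coord e lam k x) 0
  rw [add_zero] at h
  exact (h.mul_const _).deriv

variable [CompleteSpace X] [SecondCountableTopology X] [MeasurableSpace X] [BorelSpace X]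
  {γ : Measure X} [IsGaussian γ] {e : HilbertBasis ℕ ℝ X} {lam : ℕ → ℝ}

theorem norm_cylField_faceField_le_one (he : IsEigensystem γ e lam) (hlam : ∀ j, 0 < lam j)
    (r : ℕ → ℝ) (n N : ℕ) (x : X) :
    ‖cylField γ (faceField e lam r n N) (fun k : Fin N ↦ cmCoord γ e lam k) x‖ ≤ 1 := by
  have ho : Orthonormal ℝ fun k : Fin N ↦ cmCoord γ e lam k :=
    (he.orthonormal_cmCoord hlam).comp _ Fin.val_injective
  have h : ‖cylField γ (faceField e lam r n N) (fun k : Fin N ↦ cmCoord γ e lam k) x‖ ^ 2 =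
      ∑ k, faceField e lam r n N k x ^ 2 := by
    rw [← real_inner_self_eq_norm_sq, cylField, ho.inner_sum]
    simp [sq]
  refine (sq_le_one_iff₀ (norm_nonneg _)).1 ?_
  rw [h]
  exact sum_faceField_sq_le_one e lam r n N x

/-- The left side is the divergence integral of an admissible field, evaluated face by face. -/
theorem le_perimeter_of_faceField (he : IsEigensystem γ e lam) (hc : ∫ x, x ∂γ = 0)
    (hlam : ∀ j, 0 < lam j) {r : ℕ → ℝ} (hr : ∀ k, 0 < r k) (n N : ℕ) :
    ENNReal.ofReal (∑ k : Fin N, 2 * gaussianPDFReal 0 1 (r k) *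
      ∫ x in boxEvent (fun j ↦ coord e lam j) r {(k : ℕ)}ᶜ,
        cutoffProd (fun j ↦ coord e lam j) r n
          ((Finset.univ.erase k).map Fin.valEmbedding) x ∂γ) ≤
    perimeter γ (boxEvent (fun j ↦ coord e lam j) r Set.univ) := by
  have hm : ∀ i, Measurable fun x ↦ coord e lam i x := fun i ↦ by fun_prop
  have hlaw := he.map_coord hc hlam
  have hi := he.iIndepFun_coord hc hlam
  refine le_trans (le_of_eq ?_) (le_iSup_of_le N <| le_iSup_of_le (faceField e lam r n N) <|
    le_iSup_of_le (fun k : Fin N ↦ cmCoord γ e lam k) <|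
    le_iSup_of_le (isCylindricalC1b_faceField e lam r n N) <|
    le_iSup_of_le (norm_cylField_faceField_le_one he hlam r n N) le_rfl)
  congr 1
  have hprod : ∀ (k : Fin N) (x : X), cutoffProd (fun j ↦ coord e lam j) r n
      ((Finset.univ.erase k).map Fin.valEmbedding) x =
      ∏ j ∈ Finset.univ.erase k, faceCutoff n (r j) (coord e lam j x) := fun k x ↦ by
    rw [cutoffProd, Finset.prod_map]
    rfl
  have hdiv : ∀ᵐ x ∂γ, cylDiv γ (faceField e lam r n N) (fun k : Fin N ↦ cmCoord γ e lam k) x =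
      ∑ k : Fin N, (faceProfileDeriv n (r k) (coord e lam k x) -
        coord e lam k x * faceProfile n (r k) (coord e lam k x)) *
        cutoffProd (fun j ↦ coord e lam j) r n
          ((Finset.univ.erase k).map Fin.valEmbedding) x := by
    have hall : ∀ᵐ x ∂γ, ∀ k : Fin N, (cmCoord γ e lam k : Lp ℝ 2 γ) x = coord e lam k x :=
      ae_all_iff.2 fun k ↦ coeFn_cmCoord k
    filter_upwards [hall] with x hx
    refine Finset.sum_congr rfl fun k _ ↦ ?_
    rw [he.cmEmbed_cmCoord hlam, fderiv_faceField e hlam, hx, hprod, faceField]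
    ring
  rw [integral_congr_ae (ae_restrict_of_ae hdiv), integral_finsetSum]
  · exact Finset.sum_congr rfl fun k _ ↦
      (setIntegral_box_face hi hm hlaw hr n k _ (by simp)).symm
  · intro k _
    refine Integrable.restrict ?_
    have hd : Integrable (fun x ↦ faceProfileDeriv n (r k) (coord e lam k x)) γ :=
      Integrable.of_bound
        ((continuous_faceProfileDeriv n (r k)).measurable.comp (hm k)).aestronglyMeasurable _
        (.of_forall fun x ↦ abs_faceProfileDeriv_le n (hr k) _)
    have hg : Integrable (fun x ↦ coord e lam k x * faceProfile n (r k) (coord e lam k x)) γ :=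
      (IsGaussian.integrable_dual γ (coord e lam k)).mul_bdd (c := 1)
        ((continuous_faceProfile n (r k)).measurable.comp (hm k)).aestronglyMeasurable
        (.of_forall fun x ↦ abs_faceProfile_le_one _ _ _)
    refine (hd.sub hg).mul_bdd (c := 1) (measurable_cutoffProd hm r n _).aestronglyMeasurable
      (.of_forall fun x ↦ ?_)
    rw [Real.norm_of_nonneg (cutoffProd_nonneg ..)]
    exact cutoffProd_le_one ..

/-- A Hilbert cube of positive measure has infinite perimeter if the Gaussian densities at its
half side lengths are not summable. -/
theorem perimeter_box_eq_top (he : IsEigensystem γ e lam) (hc : ∫ x, x ∂γ = 0)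
    (hlam : ∀ j, 0 < lam j) {r : ℕ → ℝ} (hr : ∀ k, 0 < r k)
    (hpos : 0 < γ (boxEvent (fun j ↦ coord e lam j) r Set.univ))
    (hns : ¬ Summable fun k ↦ Real.exp (-r k ^ 2 / 2)) :
    perimeter γ (boxEvent (fun j ↦ coord e lam j) r Set.univ) = ∞ := by
  have hm : ∀ i, Measurable fun x ↦ coord e lam i x := fun i ↦ by fun_prop
  set B := boxEvent (fun j x ↦ coord e lam j x) r
  have hlow : ∀ N : ℕ, ENNReal.ofReal
      (2 * (√(2 * Real.pi))⁻¹ * γ.real (B Set.univ) *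
        ∑ k ∈ Finset.range N, Real.exp (-r k ^ 2 / 2)) ≤ perimeter γ (B Set.univ) := by
    intro N
    have hlim : Tendsto (fun n ↦ ∑ k : Fin N, 2 * gaussianPDFReal 0 1 (r k) *
        ∫ x in B {(k : ℕ)}ᶜ, cutoffProd (fun j ↦ coord e lam j) r n
          ((Finset.univ.erase k).map Fin.valEmbedding) x ∂γ) atTop
        (nhds (∑ k : Fin N, 2 * gaussianPDFReal 0 1 (r k) * γ.real (B {(k : ℕ)}ᶜ))) := by
      refine tendsto_finsetSum _ fun k _ ↦ Tendsto.const_mul _ ?_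
      refine tendsto_setIntegral_cutoffProd hm (he.map_coord hc hlam) r _ _ fun j hj hjk ↦ ?_
      rw [Set.mem_singleton_iff] at hjk
      simp [hjk] at hj
    -- The number `N` of face pairs is fixed while `n` tends to infinity; `N` grows only at the end.
    refine le_trans (ENNReal.ofReal_le_ofReal ?_) (le_of_tendsto
      (ENNReal.tendsto_ofReal hlim)
      (.of_forall fun n ↦ le_perimeter_of_faceField he hc hlam hr n N))
    rw [← Fin.sum_univ_eq_sum_range (fun k ↦ Real.exp (-r k ^ 2 / 2)), Finset.mul_sum]
    refine Finset.sum_le_sum fun k _ ↦ ?_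
    -- Dropping a constraint enlarges the box, which bounds all face weights below with one
    -- constant.
    have hmono : γ.real (B Set.univ) ≤ γ.real (B {(k : ℕ)}ᶜ) :=
      measureReal_mono fun x hx i _ ↦ hx i trivial
    rw [gaussianPDFReal_zero_one]
    calc 2 * (√(2 * Real.pi))⁻¹ * γ.real (B Set.univ) * Real.exp (-r k ^ 2 / 2)
        = 2 * ((√(2 * Real.pi))⁻¹ * Real.exp (-r k ^ 2 / 2)) * γ.real (B Set.univ) := by ring
      _ ≤ _ := by gcongr
  have hdiv := (not_summable_iff_tendsto_nat_atTop_of_nonneg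
    fun k ↦ (Real.exp_pos (-r k ^ 2 / 2)).le).1 hns
  have hγ : 0 < γ.real (B Set.univ) := ENNReal.toReal_pos hpos.ne' (measure_ne_top _ _)
  rw [← top_le_iff]
  exact le_of_tendsto (ENNReal.tendsto_ofReal_atTop.comp
    (hdiv.const_mul_atTop (by positivity))) (.of_forall hlow)

end Perimeter

/-- Eventually `sideLength k ^ 2 ≤ 4 log (k + 2) ≤ 8 log (k + 1)`, because `k + 2 ≤ (k + 1) ^ 2`. -/
theorem summable_mul_sideLength_sq {lam : ℕ → ℝ} (hlam : ∀ j, 0 < lam j)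
    (hs : Summable fun j : ℕ ↦ lam j * Real.log ((j : ℝ) + 1)) :
    Summable fun k ↦ (√(lam k) * sideLength k) ^ 2 := by
  refine Summable.of_norm_bounded_eventually_nat (hs.mul_left 8) ?_
  filter_upwards [eventually_sideLength_bounds, eventually_ge_atTop 1] with k hk hk1
  have hk1' : (1 : ℝ) ≤ k := by exact_mod_cast hk1
  rw [Real.norm_of_nonneg (sq_nonneg _), mul_pow, Real.sq_sqrt (hlam k).le]
  have h0 : 0 ≤ Real.log ((k : ℝ) + 2) := Real.log_nonneg (by linarith)
  have h1 : sideLength k ^ 2 ≤ 4 * Real.log ((k : ℝ) + 2) := by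
    calc sideLength k ^ 2 ≤ (2 * √(Real.log ((k : ℝ) + 2))) ^ 2 :=
          pow_le_pow_left₀ (sideLength_pos k).le hk.2 2
      _ = _ := by rw [mul_pow, Real.sq_sqrt h0]; norm_num
  have h2 : Real.log ((k : ℝ) + 2) ≤ 2 * Real.log ((k : ℝ) + 1) := by
    have := Real.log_le_log (by positivity) (by nlinarith : (k : ℝ) + 2 ≤ (k + 1) ^ 2)
    rwa [Real.log_pow, Nat.cast_ofNat] at this
  nlinarith [hlam k]

end GaussPerimeter

/-- Numbering starts at 0, so `log (k + 1)` and `log j` of the usual numbering become `log (k + 2)`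
and `log (j + 1)`. -/
theorem proposition5p1 :
    ∃ r : ℕ → ℝ, (∀ k, 0 < r k) ∧
      (∀ᶠ k : ℕ in atTop, √(Real.log ((k : ℝ) + 2)) ≤ r k ∧
        r k ≤ 2 * √(Real.log ((k : ℝ) + 2))) ∧
      ∀ (X : Type*) [NormedAddCommGroup X] [InnerProductSpace ℝ X] [CompleteSpace X]
        [SecondCountableTopology X] [MeasurableSpace X] [BorelSpace X]
        (γ : Measure X) [IsGaussian γ],
        ¬ FiniteDimensional ℝ X →
        ∫ x, x ∂γ = 0 →
        GaussPerimeter.IsNondegenerate γ →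
        (∃ (e : HilbertBasis ℕ ℝ X) (lam : ℕ → ℝ), GaussPerimeter.IsEigensystem γ e lam) ∧
        ∀ (e : HilbertBasis ℕ ℝ X) (lam : ℕ → ℝ), GaussPerimeter.IsEigensystem γ e lam →
          IsClosed (GaussPerimeter.hilbertCube e (fun k ↦ √(lam k) * r k)) ∧
          Convex ℝ (GaussPerimeter.hilbertCube e (fun k ↦ √(lam k) * r k)) ∧
          0 < γ (GaussPerimeter.hilbertCube e (fun k ↦ √(lam k) * r k)) ∧
          GaussPerimeter.perimeter γ
            (GaussPerimeter.hilbertCube e (fun k ↦ √(lam k) * r k)) = ∞ ∧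
          ((Summable fun j : ℕ ↦ lam j * Real.log ((j : ℝ) + 1)) →
            IsCompact (GaussPerimeter.hilbertCube e (fun k ↦ √(lam k) * r k))) := by
  open GaussPerimeter in
  refine ⟨sideLength, sideLength_pos, eventually_sideLength_bounds, ?_⟩
  intro X _ _ _ _ _ _ γ _ hinf hc hnd
  refine ⟨exists_isEigensystem γ hinf hc hnd, fun e lam he ↦ ?_⟩
  have hlam := he.lam_pos hc hnd
  have hpos : 0 < γ (boxEvent (fun j ↦ coord e lam j) sideLength Set.univ) := by
    refine measure_boxEvent_univ_pos (he.iIndepFun_coord hc hlam) (fun i ↦ by fun_prop)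
      (he.map_coord hc hlam) sideLength_pos ?_
    exact summable_exp_neg_sideLength_sq_div.of_nonneg_of_le (fun _ ↦ measureReal_nonneg)
      fun k ↦ gaussianReal_real_compl_Icc_le (sideLength_pos k)
  refine ⟨isClosed_hilbertCube e _, convex_hilbertCube e _, ?_, ?_, fun hs ↦ ?_⟩
  · rwa [hilbertCube_eq_boxEvent e hlam]
  · rw [hilbertCube_eq_boxEvent e hlam]
    exact perimeter_box_eq_top he hc hlam sideLength_pos hpos not_summable_exp_neg_sideLength_sq
  · exact isCompact_hilbertCube e (summable_mul_sideLength_sq hlam hs)
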